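/- Let $\Bbbk\in\{\mathbb R,\mathbb C\}$. An *operator space* is a $\Bbbk$-vector space $E$ with a norm on each $M_n(E)$ such that $\|\alpha x\beta\|_m\le\|\alpha\|\,\|x\|_n\,\|\beta\|$ for $x\in M_n(E)$ and scalar matrices $\alpha\in M_{m,n}$, $\beta\in M_{n,m}$ (with their operator norms), and $\|x\oplus y\|_{m+n}=\max(\|x\|_m,\|y\|_n)$; completeness is not required. Let $\mathrm{OSp}$ be the category of operator spaces and completely contractive linear maps, i.e. linear maps $f$ with $\|f_n(x)\|_n\le\|x\|_n$ for all $n$ and $x$, where $f_n$ applies $f$ entrywise. An *operator system* is a $\Bbbk$-vector space $S$ with a conjugate-linear involution $*$, convex cones $C_n\subseteq M_n(S)_{sa}$ with $C_n\cap(-C_n)=\{0\}$ and $\alpha^*C_n\alpha\subseteq C_m$ for all scalar $\alpha\in M_{n,m}$, and an element $e=e^*$ such that, for every $n$, $e_n=\mathrm{diag}(e,\dots,e)$ is an Archimedean order unit of $M_n(S)_{sa}$; the zero space is allowed and completeness is not required. Let $\mathrm{OSys}$ be the category of operator systems and unital completely positive linear maps. Every operator system is an operator space under the norms determined by, for $r\ge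 0$, $$\|s\|_n\le r\iff\begin{pmatrix} re_n&s\\ s^*&re_n\end{pmatrix}\in C_{2n},$$ and unital completely positive maps are completely contractive for these norms; this gives a forgetful functor $U:\mathrm{OSys}\to\mathrm{OSp}$. **Theorem.** 1. The categories $\mathrm{OSp}$ and $\mathrm{OSys}$ are both locally $\aleph_1$-presentable. 2. The functor $U$ has a left adjoint and is faithful. A completely contractive linear map $f:U(S)\to U(T)$ is of the form $U(g)$ for some morphism $g:S\to T$ of $\mathrm{OSys}$ if and only if $f(e_S)=e_T$. 3. The functor $U$ preserves $\aleph_1$-filtered (equivalently, $\aleph_1$-directed) colimits, and these colimits are computed set-theoretically in both categories, i.e. they are preserved by the forgetful functors $\mathrm{OSp}\to\mathrm{Set}$ and $\mathrm{OSys}\to\mathrm{Set}$. -/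

import Mathlib

open CategoryTheory
open scoped Matrix

universe w

noncomputable section

namespace OpCat

/-! ### Scalar matrices acting on matrices over a vector space -/

section Sandwich

variable {𝕜 V : Type*} [RCLike 𝕜] [AddCommGroup V] [Module 𝕜 V]

/-- The product `X A Y` of a scalar matrix `X`, a matrix `A` with entries in the vector space `V`,
and a scalar matrix `Y`. -/
def sandwich {m n p q : Type*} [Fintype n] [Fintype p]
    (X : Matrix m n 𝕜) (A : Matrix n p V) (Y : Matrix p q 𝕜) : Matrix m q V :=
  Matrix.of fun i j => ∑ k, ∑ l, (X i k * Y l j) • A k l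

/-- The block matrix with blocks `A, B, C, D`, indexed by `Fin (m + n)`. -/
def block {m n : ℕ} (A : Matrix (Fin m) (Fin m) V) (B : Matrix (Fin m) (Fin n) V)
    (C : Matrix (Fin n) (Fin m) V) (D : Matrix (Fin n) (Fin n) V) :
    Matrix (Fin (m + n)) (Fin (m + n)) V :=
  Matrix.reindex finSumFinEquiv finSumFinEquiv (Matrix.fromBlocks A B C D)

end Sandwich

/-! ### Operator spaces -/

open scoped Matrix.Norms.L2Operator in
/-- An (abstract) operator space structure on the `𝕜`-vector space `V`: a norm on every matrix
space `Mₙ(V)`, subject to Ruan's two axioms. Scalar matrices carry the operator norm between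
Euclidean spaces. No completeness is assumed. -/
structure OperatorSpaceStructure (𝕜 : Type) [RCLike 𝕜] (V : Type w)
    [AddCommGroup V] [Module 𝕜 V] where
  /-- The norm on `Mₙ(V)`. -/
  matNorm (n : ℕ) : Seminorm 𝕜 (Matrix (Fin n) (Fin n) V)
  eq_zero_of_matNorm {n : ℕ} (A : Matrix (Fin n) (Fin n) V) : matNorm n A = 0 → A = 0
  matNorm_sandwich_le {m n : ℕ} (X : Matrix (Fin m) (Fin n) 𝕜) (A : Matrix (Fin n) (Fin n) V)
    (Y : Matrix (Fin n) (Fin m) 𝕜) :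
    matNorm m (sandwich X A Y) ≤ ‖X‖ * matNorm n A * ‖Y‖
  matNorm_directSum {m n : ℕ} (A : Matrix (Fin m) (Fin m) V) (B : Matrix (Fin n) (Fin n) V) :
    matNorm (m + n) (block A 0 0 B) = max (matNorm m A) (matNorm n B)

/-- The category of (possibly non-complete) operator spaces: objects. -/
structure OSp (𝕜 : Type) [RCLike 𝕜] where
  carrier : Type w
  [addCommGroup : AddCommGroup carrier]
  [module : Module 𝕜 carrier]
  str : OperatorSpaceStructure 𝕜 carrier

attribute [instance] OSp.addCommGroup OSp.module

namespace OSp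

variable {𝕜 : Type} [RCLike 𝕜]

instance : CoeSort (OSp.{w} 𝕜) (Type w) := ⟨OSp.carrier⟩

/-- Completely contractive linear maps. -/
@[ext]
structure Hom (X Y : OSp.{w} 𝕜) where
  toLin : X →ₗ[𝕜] Y
  completelyContractive : ∀ (n : ℕ) (A : Matrix (Fin n) (Fin n) X),
    Y.str.matNorm n (A.map toLin) ≤ X.str.matNorm n A

instance (X Y : OSp.{w} 𝕜) : FunLike (Hom X Y) X Y where
  coe f := f.toLin
  coe_injective _ _ h := Hom.ext (DFunLike.coe_injective h)

instance : Category.{w} (OSp.{w} 𝕜) where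
  Hom X Y := Hom X Y
  id X := ⟨LinearMap.id, fun _ _ => le_rfl⟩
  comp f g := ⟨g.toLin.comp f.toLin, fun n A =>
    (g.completelyContractive n (A.map f.toLin)).trans (f.completelyContractive n A)⟩

instance : ConcreteCategory (OSp.{w} 𝕜) Hom where
  hom f := f
  ofHom f := f
  id_apply _ := rfl
  comp_apply _ _ _ := rfl

end OSp

/-! ### Operator systems -/

/-- An (abstract) operator system structure on the `*`-vector space `V`: cones of Hermitian
elements in every `Mₙ(V)` making `V` a matrix-ordered `*`-vector space, and an Archimedean matrix
order unit. The zero space (with unit `0`) is allowed; no completeness is assumed. -/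
structure OperatorSystemStructure (𝕜 : Type) [RCLike 𝕜] (V : Type w)
    [AddCommGroup V] [Module 𝕜 V] [StarAddMonoid V] [StarModule 𝕜 V] where
  /-- The cone of positive elements of `Mₙ(V)`. -/
  cone (n : ℕ) : Set (Matrix (Fin n) (Fin n) V)
  /-- The order unit. -/
  unit : V
  isHermitian_of_mem {n : ℕ} {A : Matrix (Fin n) (Fin n) V} : A ∈ cone n → A.IsHermitian
  zero_mem (n : ℕ) : 0 ∈ cone n
  add_mem {n : ℕ} {A B : Matrix (Fin n) (Fin n) V} : A ∈ cone n → B ∈ cone n → A + B ∈ cone n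
  conj_mem {m n : ℕ} {A : Matrix (Fin n) (Fin n) V} (X : Matrix (Fin n) (Fin m) 𝕜) :
    A ∈ cone n → sandwich Xᴴ A X ∈ cone m
  eq_zero_of_mem {n : ℕ} {A : Matrix (Fin n) (Fin n) V} : A ∈ cone n → -A ∈ cone n → A = 0
  star_unit : star unit = unit
  order_unit {n : ℕ} (A : Matrix (Fin n) (Fin n) V) : A.IsHermitian →
    ∃ r : ℝ, 0 < r ∧ (r : 𝕜) • Matrix.diagonal (fun _ => unit) - A ∈ cone n
  archimedean {n : ℕ} (A : Matrix (Fin n) (Fin n) V) : A.IsHermitian →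
    (∀ r : ℝ, 0 < r → (r : 𝕜) • Matrix.diagonal (fun _ => unit) + A ∈ cone n) → A ∈ cone n

/-- The category of operator systems: objects. -/
structure OSys (𝕜 : Type) [RCLike 𝕜] where
  carrier : Type w
  [addCommGroup : AddCommGroup carrier]
  [module : Module 𝕜 carrier]
  [starAddMonoid : StarAddMonoid carrier]
  [starModule : StarModule 𝕜 carrier]
  str : OperatorSystemStructure 𝕜 carrier

attribute [instance] OSys.addCommGroup OSys.module OSys.starAddMonoid OSys.starModule

namespace OSys

variable {𝕜 : Type} [RCLike 𝕜]

instance : CoeSort (OSys.{w} 𝕜) (Type w) := ⟨OSys.carrier⟩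

/-- Unital completely positive linear maps. -/
@[ext]
structure Hom (S T : OSys.{w} 𝕜) where
  toLin : S →ₗ[𝕜] T
  map_unit : toLin S.str.unit = T.str.unit
  completelyPositive : ∀ (n : ℕ) (A : Matrix (Fin n) (Fin n) S),
    A ∈ S.str.cone n → A.map toLin ∈ T.str.cone n

instance (S T : OSys.{w} 𝕜) : FunLike (Hom S T) S T where
  coe f := f.toLin
  coe_injective _ _ h := Hom.ext (DFunLike.coe_injective h)

instance : Category.{w} (OSys.{w} 𝕜) where
  Hom S T := Hom S T
  id S := ⟨LinearMap.id, rfl, fun _ _ h => h⟩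
  comp f g := ⟨g.toLin.comp f.toLin,
    (congrArg g.toLin f.map_unit).trans g.map_unit, fun n A h =>
    g.completelyPositive n (A.map f.toLin) (f.completelyPositive n A h)⟩

instance : ConcreteCategory (OSys.{w} 𝕜) Hom where
  hom f := f
  ofHom f := f
  id_apply _ := rfl
  comp_apply _ _ _ := rfl

end OSys

/-! ### The operator space underlying an operator system -/

namespace OperatorSystemStructure

variable {𝕜 : Type} [RCLike 𝕜] {V : Type w} [AddCommGroup V] [Module 𝕜 V] [StarAddMonoid V]
  [StarModule 𝕜 V] (S : OperatorSystemStructure 𝕜 V)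

/-- The matrix `[[r e, A], [A*, r e]]`. -/
def normBlock {n : ℕ} (r : ℝ) (A : Matrix (Fin n) (Fin n) V) :
    Matrix (Fin (n + n)) (Fin (n + n)) V :=
  block ((r : 𝕜) • Matrix.diagonal (fun _ => S.unit)) A Aᴴ
    ((r : 𝕜) • Matrix.diagonal (fun _ => S.unit))

/-- The matrix norms of an operator system: `‖A‖ₙ` is the least `r ≥ 0` such that
`[[r e, A], [A*, r e]] ≥ 0`. -/
def normFun (n : ℕ) (A : Matrix (Fin n) (Fin n) V) : ℝ :=
  sInf {r : ℝ | 0 ≤ r ∧ S.normBlock r A ∈ S.cone (n + n)}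

/-- Positivity for matrices indexed by an arbitrary finite type. -/
def Pos {ι : Type} (A : Matrix ι ι V) : Prop :=
  ∃ (n : ℕ) (e : ι ≃ Fin n), A.submatrix e.symm e.symm ∈ S.cone n

lemma submatrix_mem {m n : ℕ} {A : Matrix (Fin n) (Fin n) V} (h : A ∈ S.cone n)
    (g : Fin m → Fin n) : A.submatrix g g ∈ S.cone m := by
  have := S.conj_mem (Matrix.of fun k j => if k = g j then (1 : 𝕜) else 0) h
  convert this using 1
  ext i j
  simp [sandwich, apply_ite (star : 𝕜 → 𝕜), ite_smul]

lemma pos_iff {ι : Type} {n : ℕ} (e : ι ≃ Fin n) (A : Matrix ι ι V) :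
    S.Pos A ↔ A.submatrix e.symm e.symm ∈ S.cone n := by
  refine ⟨?_, fun h => ⟨n, e, h⟩⟩
  rintro ⟨m, f, h⟩
  have := S.submatrix_mem h (f ∘ e.symm)
  simpa [Matrix.submatrix_submatrix, Function.comp_def] using this

lemma pos_fin {n : ℕ} (A : Matrix (Fin n) (Fin n) V) : S.Pos A ↔ A ∈ S.cone n :=
  S.pos_iff (Equiv.refl _) A

lemma normBlock_mem_iff {n : ℕ} (r : ℝ) (A : Matrix (Fin n) (Fin n) V) :
    S.normBlock r A ∈ S.cone (n + n) ↔
      S.Pos (Matrix.fromBlocks ((r : 𝕜) • Matrix.diagonal (fun _ => S.unit)) A Aᴴ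
        ((r : 𝕜) • Matrix.diagonal (fun _ => S.unit))) :=
  (S.pos_iff finSumFinEquiv _).symm

variable {S}

lemma Pos.add {ι : Type} [Fintype ι] {A B : Matrix ι ι V} (hA : S.Pos A) (hB : S.Pos B) :
    S.Pos (A + B) := by
  rw [S.pos_iff (Fintype.equivFin ι)] at *
  exact S.add_mem hA hB

lemma Pos.conj {ι κ : Type} [Fintype ι] [Fintype κ] {A : Matrix ι ι V} (hA : S.Pos A)
    (X : Matrix ι κ 𝕜) : S.Pos (sandwich Xᴴ A X) := by
  rw [S.pos_iff (Fintype.equivFin ι)] at hA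
  rw [S.pos_iff (Fintype.equivFin κ)]
  have := S.conj_mem (X.submatrix (Fintype.equivFin ι).symm (Fintype.equivFin κ).symm) hA
  convert this using 1
  ext i j
  simp only [sandwich, Matrix.submatrix_apply, Matrix.of_apply, Matrix.conjTranspose_apply]
  rw [← (Fintype.equivFin ι).symm.sum_comp]
  refine Finset.sum_congr rfl fun k _ => ?_
  rw [← (Fintype.equivFin ι).symm.sum_comp]

lemma Pos.submatrix {ι κ : Type} [Fintype ι] [Fintype κ] {A : Matrix ι ι V} (hA : S.Pos A)
    (g : κ → ι) : S.Pos (A.submatrix g g) := by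
  rw [S.pos_iff (Fintype.equivFin ι)] at hA
  rw [S.pos_iff (Fintype.equivFin κ)]
  have := S.submatrix_mem hA (Fintype.equivFin ι ∘ g ∘ (Fintype.equivFin κ).symm)
  simpa [Matrix.submatrix_submatrix, Function.comp_def] using this

variable (S)

lemma diagonal_smul_submatrix {ι κ : Type} [DecidableEq ι] [DecidableEq κ] (e : ι ≃ κ) (r : 𝕜) :
    (r • Matrix.diagonal (fun _ : ι => S.unit)).submatrix e.symm e.symm =
      r • Matrix.diagonal (fun _ : κ => S.unit) := by
  ext i j
  simp [Matrix.diagonal_apply]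

lemma pos_unit (ι : Type) [Fintype ι] [DecidableEq ι] :
    S.Pos (Matrix.diagonal (fun _ : ι => S.unit)) := by
  obtain ⟨r, hr, h⟩ := S.order_unit (n := Fintype.card ι) 0 (by simp [Matrix.IsHermitian])
  rw [sub_zero] at h
  have h2 : S.Pos ((r : 𝕜) • Matrix.diagonal (fun _ : ι => S.unit)) := by
    rw [S.pos_iff (Fintype.equivFin ι), diagonal_smul_submatrix]; exact h
  have h3 := h2.conj (Matrix.diagonal (fun _ : ι => (((Real.sqrt r)⁻¹ : ℝ) : 𝕜)))
  convert h3 using 1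
  ext i j
  by_cases hij : i = j
  · subst hij
    have : (((Real.sqrt r)⁻¹ : ℝ) : 𝕜) * (((Real.sqrt r)⁻¹ : ℝ) : 𝕜) * (r : 𝕜) = 1 := by
      norm_cast
      rw [← mul_inv, Real.mul_self_sqrt hr.le, inv_mul_cancel₀ hr.ne']
    simp only [sandwich, Matrix.of_apply, Matrix.smul_apply, Matrix.diagonal_apply,
      Matrix.conjTranspose_apply]
    rw [Finset.sum_eq_single i, Finset.sum_eq_single i]
    · simp only [if_true, RCLike.star_def, RCLike.conj_ofReal, smul_smul, this, one_smul]
    · intro b _ hb; simp [hb]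
    · simp
    · intro b _ hb; simp [hb]
    · simp
  · simp only [sandwich, Matrix.of_apply, Matrix.smul_apply, Matrix.diagonal_apply,
      Matrix.conjTranspose_apply, if_neg hij]
    symm
    refine Finset.sum_eq_zero fun k _ => Finset.sum_eq_zero fun l _ => ?_
    by_cases hk : k = i <;> by_cases hl : l = j <;> by_cases hkl : k = l <;> simp_all

open scoped ComplexOrder MatrixOrder in
/-- For a positive semidefinite scalar matrix `P`, the matrix `P ⊗ e` is positive. -/
lemma pos_of_posSemidef {ι : Type} [Fintype ι] [DecidableEq ι] {P : Matrix ι ι 𝕜}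
    (hP : P.PosSemidef) : S.Pos (P.map fun c => c • S.unit) := by
  obtain ⟨Y, rfl⟩ : ∃ Y : Matrix ι ι 𝕜, P = Yᴴ * Y :=
    ⟨CFC.sqrt P, by
      rw [(Matrix.nonneg_iff_posSemidef.mp (CFC.sqrt_nonneg P)).isHermitian.eq, CFC.sqrt_mul_sqrt_self P hP.nonneg]⟩
  convert (S.pos_unit ι).conj Y using 1
  ext i j
  simp [sandwich, Matrix.mul_apply, Matrix.diagonal_apply, Finset.sum_smul]

lemma Pos.fromBlocks {ι κ : Type} [Fintype ι] [Fintype κ] [DecidableEq ι] [DecidableEq κ]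
    {A : Matrix ι ι V} {B : Matrix κ κ V} (hA : S.Pos A) (hB : S.Pos B) :
    S.Pos (Matrix.fromBlocks A 0 0 B) := by
  have h1 := hA.conj (Matrix.fromCols (1 : Matrix ι ι 𝕜) (0 : Matrix ι κ 𝕜))
  have h2 := hB.conj (Matrix.fromCols (0 : Matrix κ ι 𝕜) (1 : Matrix κ κ 𝕜))
  convert h1.add h2 using 1
  ext (i | i) (j | j) <;>
    simp [sandwich, Matrix.one_apply, ite_smul]

lemma sandwich_fromBlocks {m n : Type} [Fintype m] [Fintype n] {p q : Type}
    (P : Matrix m p 𝕜) (Q : Matrix n q 𝕜) (A : Matrix m m V) (B : Matrix m n V)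
    (C : Matrix n m V) (D : Matrix n n V) :
    sandwich (Matrix.fromBlocks P 0 0 Q)ᴴ (Matrix.fromBlocks A B C D) (Matrix.fromBlocks P 0 0 Q) =
      Matrix.fromBlocks (sandwich Pᴴ A P) (sandwich Pᴴ B Q) (sandwich Qᴴ C P)
        (sandwich Qᴴ D Q) := by
  ext (i | i) (j | j) <;> simp [sandwich]

lemma conjTranspose_sandwich {m n p q : Type} [Fintype n] [Fintype p]
    (X : Matrix m n 𝕜) (A : Matrix n p V) (Y : Matrix p q 𝕜) :
    (sandwich X A Y)ᴴ = sandwich Yᴴ Aᴴ Xᴴ := by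
  ext i j
  simp only [sandwich, Matrix.conjTranspose_apply, Matrix.of_apply, star_sum, star_smul, star_mul]
  exact Finset.sum_comm

lemma sandwich_unit {m p : Type} [Fintype m] [DecidableEq m]
    (P : Matrix m p 𝕜) (c : 𝕜) :
    sandwich Pᴴ (c • Matrix.diagonal (fun _ : m => S.unit)) P =
      (c • (Pᴴ * P)).map fun c => c • S.unit := by
  ext i j
  simp [sandwich, Matrix.mul_apply, Matrix.diagonal_apply, Finset.sum_smul, smul_smul,
    Finset.mul_sum, mul_comm]

open scoped ComplexOrder Matrix.Norms.L2Operator in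
lemma posSemidef_norm_sq {m n : ℕ} (X : Matrix (Fin m) (Fin n) 𝕜) :
    ((((‖X‖ ^ 2 : ℝ) : 𝕜) • (1 : Matrix (Fin n) (Fin n) 𝕜)) - Xᴴ * X).PosSemidef := by
  rw [Matrix.posSemidef_iff_dotProduct_mulVec]
  refine ⟨?_, fun x => ?_⟩
  · simp [Matrix.IsHermitian, Matrix.conjTranspose_sub, Matrix.conjTranspose_smul]
  · have h := X.l2_opNorm_mulVec (WithLp.toLp 2 x)
    have h1 : star x ⬝ᵥ x = ((‖(WithLp.toLp 2 x : EuclideanSpace 𝕜 (Fin n))‖ ^ 2 : ℝ) : 𝕜) := by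
      rw [EuclideanSpace.norm_sq_eq]
      simp [dotProduct, RCLike.conj_mul]
    have h2 : star (X *ᵥ x) ⬝ᵥ (X *ᵥ x) =
        ((‖(WithLp.toLp 2 (X *ᵥ x) : EuclideanSpace 𝕜 (Fin m))‖ ^ 2 : ℝ) : 𝕜) := by
      rw [EuclideanSpace.norm_sq_eq]
      simp [dotProduct, RCLike.conj_mul]
    rw [Matrix.sub_mulVec, dotProduct_sub, Matrix.smul_mulVec, Matrix.one_mulVec, dotProduct_smul,
      ← Matrix.mulVec_mulVec, Matrix.dotProduct_mulVec _ Xᴴ, ← Matrix.star_mulVec, h1, h2,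
      smul_eq_mul, ← RCLike.ofReal_mul, ← RCLike.ofReal_sub, RCLike.ofReal_nonneg, sub_nonneg,
      ← mul_pow]
    exact pow_le_pow_left₀ (norm_nonneg _) h 2

lemma smul_unit_eq {n : Type} [DecidableEq n] (c : 𝕜) :
    c • Matrix.diagonal (fun _ : n => S.unit) =
      (c • (1 : Matrix n n 𝕜)).map fun c => c • S.unit := by
  ext i j
  by_cases h : i = j <;> simp [h]

/-- The positivity of `[[r e, A], [A*, r e]]`. -/
def Bd {n : ℕ} (r : ℝ) (A : Matrix (Fin n) (Fin n) V) : Prop :=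
  S.Pos (Matrix.fromBlocks ((r : 𝕜) • Matrix.diagonal (fun _ => S.unit)) A Aᴴ
    ((r : 𝕜) • Matrix.diagonal (fun _ => S.unit)))

lemma fromBlocks_unit {m n : Type} [DecidableEq m] [DecidableEq n] (c : 𝕜) :
    Matrix.fromBlocks (c • Matrix.diagonal (fun _ : m => S.unit)) 0 0
      (c • Matrix.diagonal (fun _ : n => S.unit)) =
    c • Matrix.diagonal (fun _ : m ⊕ n => S.unit) := by
  ext (i | i) (j | j) <;> simp [Matrix.diagonal_apply]

lemma pos_smul_unit (ι : Type) [Fintype ι] [DecidableEq ι] {r : ℝ} (hr : 0 ≤ r) :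
    S.Pos ((r : 𝕜) • Matrix.diagonal (fun _ : ι => S.unit)) := by
  open scoped ComplexOrder in
  rw [smul_unit_eq]
  exact S.pos_of_posSemidef (Matrix.PosSemidef.one.smul (by simpa using hr))

lemma bd_mono {n : ℕ} {r s : ℝ} (hrs : r ≤ s) {A : Matrix (Fin n) (Fin n) V} (h : S.Bd r A) :
    S.Bd s A := by
  have := h.add (S.pos_smul_unit (Fin n ⊕ Fin n) (sub_nonneg.mpr hrs))
  rw [← fromBlocks_unit, Matrix.fromBlocks_add] at this
  simpa [Bd, ← add_smul] using this

lemma bd_zero (n : ℕ) : S.Bd 0 (0 : Matrix (Fin n) (Fin n) V) := by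
  have := S.pos_smul_unit (Fin n ⊕ Fin n) le_rfl
  rw [← fromBlocks_unit] at this
  simpa [Bd] using this

lemma bd_add {n : ℕ} {r s : ℝ} {A B : Matrix (Fin n) (Fin n) V} (hA : S.Bd r A) (hB : S.Bd s B) :
    S.Bd (r + s) (A + B) := by
  have := hA.add hB
  rw [Matrix.fromBlocks_add] at this
  simpa [Bd, ← add_smul] using this

lemma exists_bd {n : ℕ} (A : Matrix (Fin n) (Fin n) V) : ∃ r : ℝ, 0 ≤ r ∧ S.Bd r A := by
  obtain ⟨r, hr, h⟩ := S.order_unit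
    (Matrix.reindex finSumFinEquiv finSumFinEquiv (Matrix.fromBlocks 0 (-A) (-A)ᴴ 0)) (by
      rw [Matrix.reindex_apply]
      exact (Matrix.IsHermitian.fromBlocks (by simp [Matrix.IsHermitian]) rfl
        (by simp [Matrix.IsHermitian])).submatrix _)
  refine ⟨r, hr.le, ?_⟩
  unfold Bd
  rw [S.pos_iff finSumFinEquiv]
  convert h using 1
  rw [← S.diagonal_smul_submatrix finSumFinEquiv, ← fromBlocks_unit, Matrix.reindex_apply]
  ext i j
  simp only [Matrix.submatrix_apply, Matrix.sub_apply]
  rcases finSumFinEquiv.symm i with i | i <;> rcases finSumFinEquiv.symm j with j | j <;> simp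

lemma isHermitian_fromBlocks {n : Type} [DecidableEq n] (r : ℝ) (A : Matrix n n V) :
    (Matrix.fromBlocks ((r : 𝕜) • Matrix.diagonal (fun _ => S.unit)) A Aᴴ
      ((r : 𝕜) • Matrix.diagonal (fun _ => S.unit))).IsHermitian := by
  have : ((r : 𝕜) • Matrix.diagonal (fun _ : n => S.unit)).IsHermitian := by
    simp [Matrix.IsHermitian, Matrix.conjTranspose_smul, Matrix.diagonal_conjTranspose,
      Pi.star_def, S.star_unit]
  exact this.fromBlocks rfl this

lemma bd_of_forall {n : ℕ} {r : ℝ} {A : Matrix (Fin n) (Fin n) V}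
    (h : ∀ ε : ℝ, 0 < ε → S.Bd (r + ε) A) : S.Bd r A := by
  unfold Bd
  rw [S.pos_iff finSumFinEquiv]
  refine S.archimedean _ ((S.isHermitian_fromBlocks r A).submatrix _) fun ε hε => ?_
  have := h ε hε
  unfold Bd at this
  rw [S.pos_iff finSumFinEquiv] at this
  convert this using 1
  rw [← S.diagonal_smul_submatrix finSumFinEquiv, ← fromBlocks_unit]
  ext i j
  simp only [Matrix.submatrix_apply, Matrix.add_apply]
  rcases finSumFinEquiv.symm i with i | i <;> rcases finSumFinEquiv.symm j with j | j <;>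
    simp [add_smul, add_comm]

lemma eq_zero_of_bd {n : ℕ} {A : Matrix (Fin n) (Fin n) V} (h : S.Bd 0 A) : A = 0 := by
  have h2 := h.conj (Matrix.fromBlocks (1 : Matrix (Fin n) (Fin n) 𝕜) 0 0
    (-1 : Matrix (Fin n) (Fin n) 𝕜))
  have h3 : sandwich (1 : Matrix (Fin n) (Fin n) 𝕜)ᴴ A (-1 : Matrix (Fin n) (Fin n) 𝕜) = -A := by
    ext i j
    simp [sandwich, Matrix.one_apply, ite_smul, apply_ite (Neg.neg : 𝕜 → 𝕜)]
  have h4 : sandwich (-1 : Matrix (Fin n) (Fin n) 𝕜)ᴴ Aᴴ (1 : Matrix (Fin n) (Fin n) 𝕜) =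
      -Aᴴ := by
    have := congrArg Matrix.conjTranspose h3
    rwa [conjTranspose_sandwich, Matrix.conjTranspose_conjTranspose,
      Matrix.conjTranspose_neg A] at this
  rw [sandwich_fromBlocks, h3, h4, sandwich_unit, sandwich_unit] at h2
  unfold Bd at h
  rw [S.pos_iff finSumFinEquiv] at h h2
  have h5 := S.eq_zero_of_mem h (by
    convert h2 using 1
    ext i j
    simp only [Matrix.submatrix_apply, Matrix.neg_apply]
    rcases finSumFinEquiv.symm i with i | i <;> rcases finSumFinEquiv.symm j with j | j <;> simp)
  ext i j
  have := congrFun (congrFun h5 (finSumFinEquiv (Sum.inl i))) (finSumFinEquiv (Sum.inr j))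
  simpa [-finSumFinEquiv_apply_left, -finSumFinEquiv_apply_right] using this

open scoped ComplexOrder Matrix.Norms.L2Operator in
lemma bd_sandwich {m n : ℕ} {r : ℝ} (hr : 0 ≤ r) {A : Matrix (Fin n) (Fin n) V} (h : S.Bd r A)
    (X : Matrix (Fin m) (Fin n) 𝕜) (Y : Matrix (Fin n) (Fin m) 𝕜) :
    S.Bd (‖X‖ * r * ‖Y‖) (sandwich X A Y) := by
  rcases eq_or_ne X 0 with rfl | hX
  · have : sandwich (0 : Matrix (Fin m) (Fin n) 𝕜) A Y = 0 := by ext i j; simp [sandwich]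
    rw [this, norm_zero, zero_mul, zero_mul]
    exact S.bd_zero m
  rcases eq_or_ne Y 0 with rfl | hY
  · have : sandwich X A (0 : Matrix (Fin n) (Fin m) 𝕜) = 0 := by ext i j; simp [sandwich]
    rw [this, norm_zero, mul_zero]
    exact S.bd_zero m
  have ha : 0 < ‖X‖ := norm_pos_iff.mpr hX
  have hb : 0 < ‖Y‖ := norm_pos_iff.mpr hY
  set a := ‖X‖ with ha'
  set b := ‖Y‖ with hb'
  set t : ℝ := Real.sqrt (b / a) with ht
  have ht0 : 0 < t := Real.sqrt_pos.mpr (div_pos hb ha)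
  have ht2 : t * t = b / a := Real.mul_self_sqrt (div_pos hb ha).le
  have h1 := h.conj (Matrix.fromBlocks ((t : 𝕜) • Xᴴ) 0 0 (((t⁻¹ : ℝ) : 𝕜) • Y))
  have hPX : (((a * r * b : ℝ) : 𝕜) • (1 : Matrix (Fin m) (Fin m) 𝕜) -
      (r : 𝕜) • (((t : 𝕜) • Xᴴ)ᴴ * ((t : 𝕜) • Xᴴ))).PosSemidef := by
    have := (posSemidef_norm_sq Xᴴ).smul (a := ((r * (t * t) : ℝ) : 𝕜))
      (by rw [RCLike.ofReal_nonneg]; positivity)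
    convert this using 1
    rw [Matrix.l2_opNorm_conjTranspose, ← ha', smul_sub, smul_smul, ← RCLike.ofReal_mul]
    congr 1
    · congr 2; rw [ht2]; field_simp
    · simp only [Matrix.conjTranspose_smul, Matrix.smul_mul, Matrix.mul_smul, smul_smul,
        RCLike.star_def, RCLike.conj_ofReal, RCLike.ofReal_mul]
  have hPY : (((a * r * b : ℝ) : 𝕜) • (1 : Matrix (Fin m) (Fin m) 𝕜) -
      (r : 𝕜) • ((((t⁻¹ : ℝ) : 𝕜) • Y)ᴴ * (((t⁻¹ : ℝ) : 𝕜) • Y))).PosSemidef := by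
    have := (posSemidef_norm_sq Y).smul (a := ((r * (t⁻¹ * t⁻¹) : ℝ) : 𝕜))
      (by rw [RCLike.ofReal_nonneg]; positivity)
    convert this using 1
    rw [← hb', smul_sub, smul_smul, ← RCLike.ofReal_mul]
    congr 1
    · congr 2; rw [← mul_inv, ht2]; field_simp
    · simp only [Matrix.conjTranspose_smul, Matrix.smul_mul, Matrix.mul_smul, smul_smul,
        RCLike.star_def, RCLike.conj_ofReal, RCLike.ofReal_mul]
  have h2 := h1.add (Pos.fromBlocks S (S.pos_of_posSemidef hPX) (S.pos_of_posSemidef hPY))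
  unfold Bd
  convert h2 using 1
  have htt : (t : 𝕜) * ((t⁻¹ : ℝ) : 𝕜) = 1 := by
    rw [← RCLike.ofReal_mul, mul_inv_cancel₀ ht0.ne', RCLike.ofReal_one]
  rw [sandwich_fromBlocks, Matrix.fromBlocks_add, sandwich_unit, sandwich_unit,
    conjTranspose_sandwich]
  congr 1
  · rw [smul_unit_eq]; ext i j; simp [sub_smul]
  · ext i j
    simp only [sandwich, Matrix.conjTranspose_smul, Matrix.conjTranspose_conjTranspose,
      Matrix.smul_apply, Matrix.of_apply, add_zero, smul_eq_mul, RCLike.star_def,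
      RCLike.conj_ofReal]
    refine Finset.sum_congr rfl fun k _ => Finset.sum_congr rfl fun l _ => ?_
    rw [mul_mul_mul_comm, htt, one_mul]
  · ext i j
    simp only [sandwich, Matrix.conjTranspose_smul,
      Matrix.smul_apply, Matrix.of_apply, add_zero, smul_eq_mul, RCLike.star_def,
      RCLike.conj_ofReal]
    refine Finset.sum_congr rfl fun k _ => Finset.sum_congr rfl fun l _ => ?_
    rw [mul_mul_mul_comm, mul_comm ((t⁻¹ : ℝ) : 𝕜), htt, one_mul]
  · rw [smul_unit_eq]; ext i j; simp [sub_smul]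

lemma bd_directSum {m n : ℕ} {r : ℝ} (A : Matrix (Fin m) (Fin m) V)
    (B : Matrix (Fin n) (Fin n) V) :
    S.Bd r (block A 0 0 B) ↔ S.Bd r A ∧ S.Bd r B := by
  constructor
  · intro h
    constructor
    · have := h.submatrix (Sum.map (finSumFinEquiv ∘ Sum.inl) (finSumFinEquiv ∘ Sum.inl) :
        Fin m ⊕ Fin m → _)
      unfold Bd
      convert this using 1
      ext (i | i) (j | j) <;> simp [block, Matrix.diagonal_apply]
    · have := h.submatrix (Sum.map (finSumFinEquiv ∘ Sum.inr) (finSumFinEquiv ∘ Sum.inr) :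
        Fin n ⊕ Fin n → _)
      unfold Bd
      convert this using 1
      ext (i | i) (j | j) <;> simp [block, Matrix.diagonal_apply]
  · rintro ⟨hA, hB⟩
    have := (Pos.fromBlocks S hA hB).submatrix
      ((Equiv.sumSumSumComm (Fin m) (Fin n) (Fin m) (Fin n)) ∘
        (Sum.map finSumFinEquiv.symm finSumFinEquiv.symm))
    unfold Bd
    convert this using 1
    ext (i | i) (j | j) <;>
    obtain ⟨i, rfl⟩ := finSumFinEquiv.surjective i <;>
    obtain ⟨j, rfl⟩ := finSumFinEquiv.surjective j <;>
    rcases i with i | i <;> rcases j with j | j <;>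
    simp [block, Matrix.diagonal_apply,
      -finSumFinEquiv_apply_left, -finSumFinEquiv_apply_right]

/-- The defining property of the matrix norms. -/
lemma normFun_le_iff {n : ℕ} {r : ℝ} (hr : 0 ≤ r) (A : Matrix (Fin n) (Fin n) V) :
    S.normFun n A ≤ r ↔ S.normBlock r A ∈ S.cone (n + n) := by
  have hne : {r : ℝ | 0 ≤ r ∧ S.normBlock r A ∈ S.cone (n + n)}.Nonempty := by
    obtain ⟨s, hs, h⟩ := S.exists_bd A
    exact ⟨s, hs, (S.normBlock_mem_iff s A).mpr h⟩
  constructor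
  · intro h
    rw [normBlock_mem_iff]
    refine S.bd_of_forall fun ε hε => ?_
    obtain ⟨s, ⟨_, hs⟩, hlt⟩ := (csInf_lt_iff ⟨0, fun _ hx => hx.1⟩ hne).mp
      (lt_of_le_of_lt h (lt_add_of_pos_right r hε))
    exact S.bd_mono hlt.le ((S.normBlock_mem_iff s A).mp hs)
  · intro h
    exact csInf_le ⟨0, fun _ hx => hx.1⟩ ⟨hr, h⟩

lemma normFun_le_iff_bd {n : ℕ} {r : ℝ} (hr : 0 ≤ r) (A : Matrix (Fin n) (Fin n) V) :
    S.normFun n A ≤ r ↔ S.Bd r A :=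
  (S.normFun_le_iff hr A).trans (S.normBlock_mem_iff r A)

lemma normFun_nonneg (n : ℕ) (A : Matrix (Fin n) (Fin n) V) : 0 ≤ S.normFun n A :=
  Real.sInf_nonneg fun _ h => h.1

lemma bd_normFun (n : ℕ) (A : Matrix (Fin n) (Fin n) V) : S.Bd (S.normFun n A) A :=
  (S.normFun_le_iff_bd (S.normFun_nonneg n A) A).mp le_rfl

open scoped Matrix.Norms.L2Operator in
/-- The operator space underlying an operator system. -/
def toOperatorSpaceStructure : OperatorSpaceStructure 𝕜 V where
  matNorm n := Seminorm.ofSMulLE (S.normFun n)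
    (le_antisymm ((S.normFun_le_iff_bd le_rfl 0).mpr (S.bd_zero n)) (S.normFun_nonneg n 0))
    (fun A B => (S.normFun_le_iff_bd
      (add_nonneg (S.normFun_nonneg n A) (S.normFun_nonneg n B)) _).mpr
      (S.bd_add (S.bd_normFun n A) (S.bd_normFun n B)))
    (fun c A => by
      have h := S.bd_sandwich (S.normFun_nonneg n A) (S.bd_normFun n A)
        (Matrix.diagonal fun _ => c) (Matrix.diagonal fun _ => 1)
      have h2 : sandwich (Matrix.diagonal fun _ => c) A
          (Matrix.diagonal fun _ => (1 : 𝕜)) = c • A := by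
        ext i j
        simp [sandwich, Matrix.diagonal_apply, ite_smul]
      rw [h2] at h
      rw [S.normFun_le_iff_bd (mul_nonneg (norm_nonneg _) (S.normFun_nonneg n A))]
      refine S.bd_mono ?_ h
      rw [Matrix.l2_opNorm_diagonal, Matrix.l2_opNorm_diagonal]
      have h3 : ‖(fun _ : Fin n => c)‖ ≤ ‖c‖ := pi_norm_const_le c
      have h4 : ‖(fun _ : Fin n => (1 : 𝕜))‖ ≤ 1 := by
        simpa using pi_norm_const_le (ι := Fin n) (1 : 𝕜)
      calc _ ≤ ‖c‖ * S.normFun n A * 1 := by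
            gcongr
            · exact mul_nonneg (norm_nonneg _) (S.normFun_nonneg n A)
            · exact S.normFun_nonneg n A
        _ = _ := mul_one _)
  eq_zero_of_matNorm {n} A h := S.eq_zero_of_bd ((S.normFun_le_iff_bd le_rfl A).mp (le_of_eq h))
  matNorm_sandwich_le {m n} X A Y :=
    (S.normFun_le_iff_bd (mul_nonneg (mul_nonneg (norm_nonneg _) (S.normFun_nonneg n A))
      (norm_nonneg _)) _).mpr (S.bd_sandwich (S.normFun_nonneg n A) (S.bd_normFun n A) X Y)
  matNorm_directSum {m n} A B := by
    change S.normFun _ _ = max (S.normFun _ _) (S.normFun _ _)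
    refine eq_of_forall_ge_iff fun r => ?_
    rcases le_or_gt 0 r with hr | hr
    · rw [max_le_iff, S.normFun_le_iff_bd hr, S.normFun_le_iff_bd hr, S.normFun_le_iff_bd hr,
        S.bd_directSum]
    · have h1 := S.normFun_nonneg _ (block A 0 0 B)
      have h2 := S.normFun_nonneg _ A
      exact ⟨fun h => absurd (h1.trans h) hr.not_ge,
        fun h => absurd (h2.trans ((le_max_left _ _).trans h)) hr.not_ge⟩

end OperatorSystemStructure

/-- A unital completely positive map is completely contractive for the matrix norms. -/
lemma OSys.Hom.completelyContractive {𝕜 : Type} [RCLike 𝕜] {S T : OSys.{w} 𝕜} (f : OSys.Hom S T)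
    (n : ℕ) (A : Matrix (Fin n) (Fin n) S) :
    T.str.normFun n (A.map f.toLin) ≤ S.str.normFun n A := by
  rw [T.str.normFun_le_iff (S.str.normFun_nonneg n A)]
  have h := f.completelyPositive _ _
    ((S.str.normFun_le_iff (S.str.normFun_nonneg n A) A).mp le_rfl)
  set r := S.str.normFun n A
  have hmap : (S.str.normBlock r A).map f.toLin =
      block ((r : 𝕜) • Matrix.diagonal (fun _ => T.str.unit)) (A.map f.toLin) (Aᴴ.map f.toLin)
        ((r : 𝕜) • Matrix.diagonal (fun _ => T.str.unit)) := by
    ext i j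
    obtain ⟨i, rfl⟩ := finSumFinEquiv.surjective i
    obtain ⟨j, rfl⟩ := finSumFinEquiv.surjective j
    rcases i with i | i <;> rcases j with j | j <;>
      simp [OperatorSystemStructure.normBlock, block, Matrix.diagonal_apply,
        apply_ite f.toLin, f.map_unit,
        -finSumFinEquiv_apply_left, -finSumFinEquiv_apply_right]
  rw [hmap] at h
  have hstar : Aᴴ.map f.toLin = (A.map f.toLin)ᴴ := by
    ext i j
    have := (T.str.isHermitian_of_mem h).apply (finSumFinEquiv (Sum.inr i))
      (finSumFinEquiv (Sum.inl j))
    simpa [block, -finSumFinEquiv_apply_left, -finSumFinEquiv_apply_right]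
      using this.symm
  rw [hstar] at h
  exact h

/-- The forgetful functor from operator systems to operator spaces. -/
def forgetToOSp (𝕜 : Type) [RCLike 𝕜] : OSys.{w} 𝕜 ⥤ OSp.{w} 𝕜 where
  obj S := { carrier := S.carrier, str := S.str.toOperatorSpaceStructure }
  map f := { toLin := f.toLin, completelyContractive := f.completelyContractive }

/-- The cardinal `ℵ₁` is regular. -/
instance fact_isRegular_aleph_one : Fact (Cardinal.aleph.{w} 1).IsRegular :=
  ⟨Cardinal.isRegular_aleph_one⟩

end OpCat

end

universe u

noncomputable section

namespace OpCat

open Limits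

/-! ### Entrywise estimates in operator spaces -/

/-! All universal objects come from one construction. Given a set X of generators and a family,
however large, of test maps from X to operator spaces, bounded at each generator, divide the free
vector space on X by the common kernel of the linear extensions and take suprema of the matrix norms
under the tests. For operator systems, adjoin formal adjoints and a unit, and call a matrix positive
when all its images are. The carrier stays in the universe of X and a bounded family of reals of any
size has a real supremum, so no solution set is needed. Testing against all cocones gives colimits;
against all complete contractions into operator systems, the left adjoint of `forgetToOSp`; against
all n × n matrices of norm at most one, the object `ballObj 𝕜 n` corepresenting the unit ball of Mₙ.

In an ℵ₁-filtered colimit infima are attained: a sequence of representatives of one matrix, with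
norms tending to the infimum, becomes a single matrix at some stage
(`IsLinColimit.exists_common_matrix`). Hence the infimum norm on the colimit of vector spaces is
definite, the Archimedean property survives, and matrices lift without increase of norm. So these
colimits live on the colimit of sets, `forgetToOSp` preserves them, and the ball objects are
ℵ₁-presentable. They form a strong generator because they detect vectors and all matrix norms.

A unital complete contraction is completely positive because y + y* ≥ 0 holds exactly when ‖1 - t y‖
≤ 1 + C t² for some C and all small t > 0, a condition on the norm and the unit alone. It needs no
imaginary unit, so it serves ℝ and ℂ alike; applied to skew-Hermitian matrices it also shows that
the map respects the involution. It follows that `forgetToOSp` reflects isomorphisms. Being also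
faithful and accessible, it has a left adjoint carrying the ball objects to a strong generator of
ℵ₁-presentable operator systems. -/

open scoped Matrix.Norms.L2Operator in
lemma l2_opNorm_le_one_of_conjTranspose_mul_self {𝕜 : Type} [RCLike 𝕜] {m n : ℕ}
    {X : Matrix (Fin m) (Fin n) 𝕜} (h : Xᴴ * X = 1) : ‖X‖ ≤ 1 := by
  have h1 := Matrix.l2_opNorm_conjTranspose_mul_self X
  rw [h, ← Matrix.diagonal_one, Matrix.l2_opNorm_diagonal] at h1
  -- Only an inequality is available: for n = 0 this norm is 0.
  have h2 : ‖(fun _ : Fin n => (1 : 𝕜))‖ ≤ 1 := by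
    simpa using pi_norm_const_le (ι := Fin n) (1 : 𝕜)
  have h3 : ‖X‖ * ‖X‖ ≤ 1 := h1 ▸ h2
  nlinarith [norm_nonneg X]

open scoped Matrix.Norms.L2Operator in
lemma l2_opNorm_unitCol_le {𝕜 : Type} [RCLike 𝕜] {n : ℕ} (j : Fin n) :
    ‖(Matrix.of fun k (_ : Fin 1) => if k = j then (1 : 𝕜) else 0)‖ ≤ 1 := by
  refine l2_opNorm_le_one_of_conjTranspose_mul_self ?_
  ext a b
  simp [Matrix.mul_apply, Matrix.one_apply, Subsingleton.elim a b]

open scoped Matrix.Norms.L2Operator in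
lemma l2_opNorm_unitRow_le {𝕜 : Type} [RCLike 𝕜] {n : ℕ} (i : Fin n) :
    ‖(Matrix.of fun (_ : Fin 1) k => if k = i then (1 : 𝕜) else 0)‖ ≤ 1 := by
  rw [← Matrix.l2_opNorm_conjTranspose]
  refine le_of_eq_of_le (congrArg _ ?_) (l2_opNorm_unitCol_le (𝕜 := 𝕜) i)
  ext a b
  simp [apply_ite (star : 𝕜 → 𝕜)]

lemma map_sandwich {𝕜 V W : Type*} [RCLike 𝕜] [AddCommGroup V] [Module 𝕜 V]
    [AddCommGroup W] [Module 𝕜 W] (f : V →ₗ[𝕜] W) {m n p q : Type*} [Fintype n] [Fintype p]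
    (X : Matrix m n 𝕜) (A : Matrix n p V) (Y : Matrix p q 𝕜) :
    (sandwich X A Y).map f = sandwich X (A.map f) Y := by
  ext i j
  simp [sandwich]

lemma map_block {𝕜 V W : Type*} [RCLike 𝕜] [AddCommGroup V] [Module 𝕜 V]
    [AddCommGroup W] [Module 𝕜 W] (f : V →ₗ[𝕜] W) {m n : ℕ}
    (A : Matrix (Fin m) (Fin m) V) (B : Matrix (Fin m) (Fin n) V)
    (C : Matrix (Fin n) (Fin m) V) (D : Matrix (Fin n) (Fin n) V) :
    (block A B C D).map f = block (A.map f) (B.map f) (C.map f) (D.map f) := by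
  simp only [block, Matrix.reindex_apply, ← Matrix.submatrix_map, Matrix.fromBlocks_map]

namespace OperatorSpaceStructure

variable {𝕜 : Type} [RCLike 𝕜] {V : Type w} [AddCommGroup V] [Module 𝕜 V]
  (E : OperatorSpaceStructure 𝕜 V)

/-- The norm of a vector, i.e. of the corresponding `1 × 1` matrix. -/
def norm₁ (v : V) : ℝ := E.matNorm 1 (Matrix.of fun _ _ => v)

lemma norm₁_nonneg (v : V) : 0 ≤ E.norm₁ v := apply_nonneg _ _

lemma norm₁_add_le (v v' : V) : E.norm₁ (v + v') ≤ E.norm₁ v + E.norm₁ v' :=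
  map_add_le_add (E.matNorm 1) (Matrix.of fun _ _ => v) (Matrix.of fun _ _ => v')

lemma norm₁_smul (c : 𝕜) (v : V) : E.norm₁ (c • v) = ‖c‖ * E.norm₁ v :=
  map_smul_eq_mul (E.matNorm 1) c (Matrix.of fun _ _ => v)

lemma norm₁_zero : E.norm₁ 0 = 0 := by
  simpa using E.norm₁_smul 0 0

-- An entry is the compression of the matrix by a unit row and a unit column.
open scoped Matrix.Norms.L2Operator in
lemma norm₁_apply_le {n : ℕ} (A : Matrix (Fin n) (Fin n) V) (i j : Fin n) :
    E.norm₁ (A i j) ≤ E.matNorm n A := by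
  have h := E.matNorm_sandwich_le (Matrix.of fun (_ : Fin 1) k => if k = i then (1 : 𝕜) else 0) A
    (Matrix.of fun k (_ : Fin 1) => if k = j then (1 : 𝕜) else 0)
  have h1 : sandwich (Matrix.of fun (_ : Fin 1) k => if k = i then (1 : 𝕜) else 0) A
    (Matrix.of fun k (_ : Fin 1) => if k = j then (1 : 𝕜) else 0) =
      Matrix.of fun _ _ => A i j := by
    ext a b
    simp [sandwich, ite_smul]
  rw [h1] at h
  refine h.trans ?_
  have h2 := l2_opNorm_unitRow_le (𝕜 := 𝕜) i
  have h3 := l2_opNorm_unitCol_le (𝕜 := 𝕜) j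
  have h4 : 0 ≤ E.matNorm n A := apply_nonneg _ _
  calc _ ≤ 1 * E.matNorm n A * 1 := by gcongr
    _ = _ := by ring

-- The matrix is the sum of its entries placed by matrix units. This carries pointwise bounds on a
-- family of maps to all matrix levels.
open scoped Matrix.Norms.L2Operator in
lemma matNorm_le_sum {n : ℕ} (A : Matrix (Fin n) (Fin n) V) :
    E.matNorm n A ≤ ∑ i, ∑ j, E.norm₁ (A i j) := by
  have hA : A = ∑ i, ∑ j, sandwich
      (Matrix.of fun k (_ : Fin 1) => if k = i then (1 : 𝕜) else 0) (Matrix.of fun _ _ => A i j)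
      (Matrix.of fun (_ : Fin 1) k => if k = j then (1 : 𝕜) else 0) := by
    ext a b
    simp [sandwich, Matrix.sum_apply, ite_smul]
  conv_lhs => rw [hA]
  have hs : ∀ g : Fin n → Matrix (Fin n) (Fin n) V,
      E.matNorm n (∑ i, g i) ≤ ∑ i, E.matNorm n (g i) := fun g =>
    Finset.le_sum_of_subadditive _ (map_zero (E.matNorm n)).le (map_add_le_add _) _ _
  refine (hs _).trans (Finset.sum_le_sum fun i _ => (hs _).trans (Finset.sum_le_sum fun j _ => ?_))
  refine (E.matNorm_sandwich_le _ _ _).trans ?_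
  have h2 := l2_opNorm_unitRow_le (𝕜 := 𝕜) j
  have h3 := l2_opNorm_unitCol_le (𝕜 := 𝕜) i
  have h4 : 0 ≤ E.norm₁ (A i j) := E.norm₁_nonneg _
  calc _ ≤ 1 * E.norm₁ (A i j) * 1 := by unfold norm₁ at *; gcongr
    _ = _ := by ring

end OperatorSpaceStructure

/-! ### Operator spaces defined by families of linear maps -/

namespace OSp

variable {𝕜 : Type} [RCLike 𝕜]

/-- The linear map underlying a morphism. -/
abbrev lin {X Y : OSp.{w} 𝕜} (f : X ⟶ Y) : X →ₗ[𝕜] Y := Hom.toLin f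

lemma hom_ext {X Y : OSp.{w} 𝕜} {f g : X ⟶ Y} (h : ∀ x, lin f x = lin g x) : f = g :=
  Hom.ext (LinearMap.ext h)

lemma matNorm_map_le {X Y : OSp.{w} 𝕜} (f : X ⟶ Y) {n : ℕ} (A : Matrix (Fin n) (Fin n) X) :
    Y.str.matNorm n (A.map (lin f)) ≤ X.str.matNorm n A :=
  Hom.completelyContractive f n A

lemma norm₁_map_le {X Y : OSp.{w} 𝕜} (f : X ⟶ Y) (x : X) :
    Y.str.norm₁ (lin f x) ≤ X.str.norm₁ x :=
  matNorm_map_le f (Matrix.of fun _ _ => x)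

section Initial

variable {V : Type w} [AddCommGroup V] [Module 𝕜 V] {I : Type u} (Z : I → OSp.{w} 𝕜)
  (φ : ∀ i, V →ₗ[𝕜] Z i)

lemma bddAbove_matNorm (hb : ∀ v, ∃ r, ∀ i, (Z i).str.norm₁ (φ i v) ≤ r)
    {n : ℕ} (A : Matrix (Fin n) (Fin n) V) :
    BddAbove (Set.range fun i => (Z i).str.matNorm n (A.map (φ i))) := by
  choose r hr using hb
  refine ⟨∑ a, ∑ b, r (A a b), ?_⟩
  rintro _ ⟨i, rfl⟩
  exact ((Z i).str.matNorm_le_sum _).trans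
    (Finset.sum_le_sum fun a _ => Finset.sum_le_sum fun b _ => hr _ i)

open scoped Matrix.Norms.L2Operator in
/-- The operator space structure defined by a pointwise bounded, jointly injective family of
linear maps to operator spaces: the matrix norms are the suprema of the norms of the images. -/
def initialStructure (hb : ∀ v, ∃ r, ∀ i, (Z i).str.norm₁ (φ i v) ≤ r)
    (hinj : ∀ v, (∀ i, φ i v = 0) → v = 0) : OperatorSpaceStructure 𝕜 V where
  -- For an empty family the supremum takes the default value 0, which is consistent since joint
  -- injectivity then forces V = 0. This is why `Real.iSup_le` is fed nonnegativity of the bound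
  -- throughout.
  matNorm n := Seminorm.ofSMulLE (fun A => ⨆ i, (Z i).str.matNorm n (A.map (φ i)))
    (by simp [Matrix.map_zero])
    (fun A B => Real.iSup_le (fun i => by
        rw [Matrix.map_add _ (map_add (φ i))]
        exact (map_add_le_add _ _ _).trans (add_le_add (le_ciSup (bddAbove_matNorm Z φ hb A) i)
          (le_ciSup (bddAbove_matNorm Z φ hb B) i)))
      (add_nonneg (Real.iSup_nonneg fun _ => apply_nonneg _ _)
        (Real.iSup_nonneg fun _ => apply_nonneg _ _)))
    (fun c A => Real.iSup_le (fun i => by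
        rw [Matrix.map_smul _ c (map_smul (φ i) c), map_smul_eq_mul]
        exact mul_le_mul_of_nonneg_left (le_ciSup (bddAbove_matNorm Z φ hb A) i) (norm_nonneg _))
      (mul_nonneg (norm_nonneg _) (Real.iSup_nonneg fun _ => apply_nonneg _ _)))
  eq_zero_of_matNorm {n} A h := by
    have h1 : ∀ i, A.map (φ i) = 0 := fun i => (Z i).str.eq_zero_of_matNorm _
      (le_antisymm ((le_ciSup (bddAbove_matNorm Z φ hb A) i).trans h.le) (apply_nonneg _ _))
    ext a b
    exact hinj _ fun i => congrFun (congrFun (h1 i) a) b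
  matNorm_sandwich_le {m n} X A Y := Real.iSup_le (fun i => by
      rw [map_sandwich]
      refine ((Z i).str.matNorm_sandwich_le X _ Y).trans ?_
      gcongr
      exact le_ciSup (bddAbove_matNorm Z φ hb A) i)
    (mul_nonneg (mul_nonneg (norm_nonneg _) (apply_nonneg _ _)) (norm_nonneg _))
  matNorm_directSum {m n} A B := by
    have h : ∀ i, (Z i).str.matNorm (m + n) ((block A 0 0 B).map (φ i)) =
        max ((Z i).str.matNorm m (A.map (φ i))) ((Z i).str.matNorm n (B.map (φ i))) := fun i => by
      rw [map_block, ← (Z i).str.matNorm_directSum]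
      simp
    refine le_antisymm (Real.iSup_le (fun i => ?_) ?_) (max_le ?_ ?_)
    · rw [h]
      exact max_le_max (le_ciSup (bddAbove_matNorm Z φ hb A) i)
        (le_ciSup (bddAbove_matNorm Z φ hb B) i)
    · exact le_max_of_le_left (Real.iSup_nonneg fun _ => apply_nonneg _ _)
    · refine Real.iSup_le (fun i => ?_) (Real.iSup_nonneg fun _ => apply_nonneg _ _)
      exact (le_max_left _ _).trans ((h i).symm.le.trans
        (le_ciSup (bddAbove_matNorm Z φ hb (block A 0 0 B)) i))
    · refine Real.iSup_le (fun i => ?_) (Real.iSup_nonneg fun _ => apply_nonneg _ _)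
      exact (le_max_right _ _).trans ((h i).symm.le.trans
        (le_ciSup (bddAbove_matNorm Z φ hb (block A 0 0 B)) i))

end Initial

/-! ### Operator spaces generated by a set, subject to a family of test maps -/

section Generated

variable {X : Type w} {I : Type u} (Z : I → OSp.{w} 𝕜) (f : ∀ i, X → Z i)

/-- The common kernel of the linear extensions of a family of maps to vector spaces. -/
def testKernel : Submodule 𝕜 (X →₀ 𝕜) :=
  ⨅ i, LinearMap.ker (Finsupp.linearCombination 𝕜 (f i))

/-- The linear map on the generated vector space induced by a test map. -/
def testMap (i : I) : ((X →₀ 𝕜) ⧸ testKernel Z f) →ₗ[𝕜] Z i :=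
  (testKernel Z f).liftQ (Finsupp.linearCombination 𝕜 (f i)) (iInf_le _ i)

/-- The image of a generator in the generated vector space. -/
def testGen (x : X) : (X →₀ 𝕜) ⧸ testKernel Z f :=
  (testKernel Z f).mkQ (Finsupp.single x 1)

@[simp]
lemma testMap_testGen (i : I) (x : X) : testMap Z f i (testGen Z f x) = f i x := by
  refine (Submodule.liftQ_apply _ _ _).trans ?_
  simp

lemma testMap_injective (v : (X →₀ 𝕜) ⧸ testKernel Z f) (h : ∀ i, testMap Z f i v = 0) :
    v = 0 := by
  obtain ⟨v, rfl⟩ := Submodule.mkQ_surjective _ v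
  refine (Submodule.Quotient.mk_eq_zero _).mpr ((Submodule.mem_iInf _).mpr fun i => ?_)
  exact (Submodule.liftQ_apply _ _ _).symm.trans (h i)

lemma testGen_induction {p : ((X →₀ 𝕜) ⧸ testKernel Z f) → Prop} (v : (X →₀ 𝕜) ⧸ testKernel Z f)
    (zero : p 0) (add : ∀ v v', p v → p v' → p (v + v'))
    (smul : ∀ (c : 𝕜) x, p (c • testGen Z f x)) : p v := by
  obtain ⟨v, rfl⟩ := Submodule.mkQ_surjective _ v
  induction v using Finsupp.induction_linear with
  | zero => simpa using zero
  | add v v' h h' => rw [map_add]; exact add _ _ h h'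
  | single x c =>
    have h := smul c x
    rwa [testGen, ← map_smul, Finsupp.smul_single, smul_eq_mul, mul_one] at h

lemma testGen_hom_ext {W : Type*} [AddCommGroup W] [Module 𝕜 W]
    {g h : ((X →₀ 𝕜) ⧸ testKernel Z f) →ₗ[𝕜] W}
    (hgh : ∀ x, g (testGen Z f x) = h (testGen Z f x)) : g = h := by
  ext v
  exact hgh v

lemma testMap_bounded (hb : ∀ x, ∃ r, ∀ i, (Z i).str.norm₁ (f i x) ≤ r)
    (v : (X →₀ 𝕜) ⧸ testKernel Z f) : ∃ r, ∀ i, (Z i).str.norm₁ (testMap Z f i v) ≤ r := by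
  induction v using testGen_induction with
  | zero => exact ⟨0, fun i => by rw [map_zero, (Z i).str.norm₁_zero]⟩
  | add v v' h h' =>
    obtain ⟨r, hr⟩ := h
    obtain ⟨r', hr'⟩ := h'
    exact ⟨r + r', fun i => by
      rw [map_add]; exact ((Z i).str.norm₁_add_le _ _).trans (add_le_add (hr i) (hr' i))⟩
  | smul c x =>
    obtain ⟨r, hr⟩ := hb x
    exact ⟨‖c‖ * r, fun i => by
      rw [map_smul, (Z i).str.norm₁_smul, testMap_testGen]
      exact mul_le_mul_of_nonneg_left (hr i) (norm_nonneg _)⟩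

variable (hb : ∀ x, ∃ r, ∀ i, (Z i).str.norm₁ (f i x) ≤ r)

/-- The operator space generated by a set `X`, with the largest matrix norms for which all the
test maps `f i : X → Z i` extend to completely contractive maps. -/
def generated : OSp.{w} 𝕜 where
  carrier := (X →₀ 𝕜) ⧸ testKernel Z f
  str := initialStructure Z (testMap Z f) (testMap_bounded Z f hb) (testMap_injective Z f)

/-- The generators of a generated operator space. -/
def gen (x : X) : generated Z f hb := testGen Z f x

/-- The extension of a test map to the generated operator space. -/
def genDesc (i : I) : generated Z f hb ⟶ Z i :=
  Hom.mk (testMap Z f i) fun _ A =>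
    le_ciSup (bddAbove_matNorm Z (testMap Z f) (testMap_bounded Z f hb) A) i

@[simp]
lemma genDesc_gen (i : I) (x : X) : lin (genDesc Z f hb i) (gen Z f hb x) = f i x :=
  testMap_testGen Z f i x

lemma gen_hom_ext {Y : OSp.{w} 𝕜} {g h : generated Z f hb ⟶ Y}
    (hgh : ∀ x, lin g (gen Z f hb x) = lin h (gen Z f hb x)) : g = h :=
  Hom.ext (testGen_hom_ext Z f hgh)

/-- Identities in a generated space are checked under each test; linearity and naturality of the
colimit legs are obtained this way. -/
lemma eq_of_genDesc {v v' : generated Z f hb}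
    (h : ∀ i, lin (genDesc Z f hb i) v = lin (genDesc Z f hb i) v') : v = v' :=
  sub_eq_zero.mp (testMap_injective Z f _ fun i => by
    have := h i
    rw [← sub_eq_zero, ← map_sub] at this
    exact this)

lemma generated_matNorm_le {n : ℕ} {A : Matrix (Fin n) (Fin n) (generated Z f hb)} {r : ℝ}
    (hr : 0 ≤ r) (h : ∀ i, (Z i).str.matNorm n (A.map (lin (genDesc Z f hb i))) ≤ r) :
    (generated Z f hb).str.matNorm n A ≤ r :=
  Real.iSup_le h hr

end Generated

/-! ### Colimits of operator spaces -/

section Colimits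

variable {J : Type w} [SmallCategory J] (F : J ⥤ OSp.{w} 𝕜)

lemma lin_cocone_w (s : Cocone F) {i j : J} (g : i ⟶ j) (x : F.obj i) :
    lin (s.ι.app j) (lin (F.map g) x) = lin (s.ι.app i) x :=
  congrArg (fun h : F.obj i ⟶ s.pt => lin h x) (s.w g)

lemma cocone_bounded (x : Σ j, F.obj j) :
    ∃ r, ∀ s : Cocone F, s.pt.str.norm₁ (lin (s.ι.app x.1) x.2) ≤ r :=
  ⟨_, fun s => norm₁_map_le (s.ι.app x.1) x.2⟩

/-- The colimit of a diagram of operator spaces. -/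
abbrev colimitObj : OSp.{w} 𝕜 :=
  generated (X := Σ j, F.obj j) (I := Cocone F) (fun s => s.pt)
    (fun s x => lin (s.ι.app x.1) x.2) (cocone_bounded F)

/-- The map from the colimit to the apex of a cocone. -/
abbrev colimitDesc (s : Cocone F) : colimitObj F ⟶ s.pt :=
  genDesc (X := Σ j, F.obj j) (I := Cocone F) (fun s => s.pt)
    (fun s x => lin (s.ι.app x.1) x.2) (cocone_bounded F) s

/-- The image in the colimit of an element of an object of the diagram. -/
abbrev colimitGen (j : J) (x : F.obj j) : colimitObj F :=
  gen (X := Σ j, F.obj j) (I := Cocone F) (fun s => s.pt)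
    (fun s x => lin (s.ι.app x.1) x.2) (cocone_bounded F) ⟨j, x⟩

lemma colimitDesc_gen (s : Cocone F) (j : J) (x : F.obj j) :
    lin (colimitDesc F s) (colimitGen F j x) = lin (s.ι.app j) x :=
  genDesc_gen _ _ _ s _

lemma eq_of_colimitDesc {v v' : colimitObj F}
    (h : ∀ s, lin (colimitDesc F s) v = lin (colimitDesc F s) v') : v = v' :=
  eq_of_genDesc _ _ _ h

/-- The colimit cocone of a diagram of operator spaces. -/
def colimitCocone : Cocone F where
  pt := colimitObj F
  ι :=
    { app j := Hom.mk
        { toFun := colimitGen F j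
          map_add' x y := eq_of_colimitDesc F fun s => by simp only [map_add, colimitDesc_gen]
          map_smul' c x := eq_of_colimitDesc F fun s => by
            simp only [map_smul, colimitDesc_gen, RingHom.id_apply] }
        fun n A => generated_matNorm_le _ _ (cocone_bounded F) (apply_nonneg _ _) fun s => by
          refine le_of_eq_of_le (congrArg _ ?_) (matNorm_map_le (s.ι.app j) A)
          ext a b
          exact colimitDesc_gen F s j _
      naturality i j g := hom_ext fun x => eq_of_colimitDesc F fun s =>
        (colimitDesc_gen F s j _).trans
          ((lin_cocone_w F s g x).trans (colimitDesc_gen F s i x).symm) }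

/-- The colimit cocone is a colimit. -/
def colimitCoconeIsColimit : IsColimit (colimitCocone F) where
  desc s := colimitDesc F s
  fac s j := hom_ext fun x => colimitDesc_gen F s j x
  uniq s _ hm := gen_hom_ext _ _ _ fun ⟨j, x⟩ =>
    (congrArg (fun h : F.obj j ⟶ s.pt => lin h x) (hm j)).trans (colimitDesc_gen F s j x).symm

end Colimits

instance : HasColimitsOfSize.{w, w} (OSp.{w} 𝕜) where
  has_colimits_of_shape _ _ := ⟨fun F => ⟨⟨⟨colimitCocone F, colimitCoconeIsColimit F⟩⟩⟩⟩

/-! ### The operator spaces representing the unit balls of the matrix spaces -/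

section Ball

variable (𝕜) (n : ℕ)

/-- A test for the ball object: a matrix in the unit ball. -/
structure BallTest where
  pt : OSp.{w} 𝕜
  mat : Matrix (Fin n) (Fin n) pt
  mat_le : pt.str.matNorm n mat ≤ 1

variable {𝕜 n} in
/-- The entries of the matrix of a test. -/
def BallTest.entry (t : BallTest.{w} 𝕜 n) (x : ULift.{w} (Fin n × Fin n)) : t.pt :=
  t.mat x.down.1 x.down.2

lemma ballTest_bounded (x : ULift.{w} (Fin n × Fin n)) :
    ∃ r, ∀ t : BallTest.{w} 𝕜 n, t.pt.str.norm₁ (t.entry x) ≤ r :=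
  ⟨1, fun t => (t.pt.str.norm₁_apply_le t.mat _ _).trans t.mat_le⟩

/-- The operator space whose morphisms to `Z` are the matrices in the unit ball of `Mₙ(Z)`. -/
def ballObj : OSp.{w} 𝕜 :=
  generated (I := BallTest.{w} 𝕜 n) (fun t => t.pt) (fun t => t.entry) (ballTest_bounded 𝕜 n)

/-- The universal matrix in the unit ball. -/
def ballMat : Matrix (Fin n) (Fin n) (ballObj.{w} 𝕜 n) :=
  Matrix.of fun i j => gen (I := BallTest.{w} 𝕜 n) (fun t => t.pt) (fun t => t.entry)
    (ballTest_bounded 𝕜 n) ⟨(i, j)⟩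

variable {𝕜 n}

/-- The morphism from the ball object given by a matrix in the unit ball. -/
def ballDesc {Z : OSp.{w} 𝕜} (A : Matrix (Fin n) (Fin n) Z) (hA : Z.str.matNorm n A ≤ 1) :
    ballObj.{w} 𝕜 n ⟶ Z :=
  genDesc (I := BallTest.{w} 𝕜 n) (fun t => t.pt) (fun t => t.entry)
    (ballTest_bounded 𝕜 n) ⟨Z, A, hA⟩

@[simp]
lemma ballMat_map_ballDesc {Z : OSp.{w} 𝕜} (A : Matrix (Fin n) (Fin n) Z)
    (hA : Z.str.matNorm n A ≤ 1) : (ballMat.{w} 𝕜 n).map (lin (ballDesc A hA)) = A := by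
  ext i j
  exact genDesc_gen (I := BallTest.{w} 𝕜 n) _ _ (ballTest_bounded 𝕜 n) ⟨Z, A, hA⟩ _

lemma matNorm_ballMat_le : (ballObj.{w} 𝕜 n).str.matNorm n (ballMat.{w} 𝕜 n) ≤ 1 :=
  generated_matNorm_le _ _ _ zero_le_one fun t => by
    have := ballMat_map_ballDesc t.mat t.mat_le
    exact (congrArg _ this).trans_le t.mat_le

lemma ballObj_hom_ext {Z : OSp.{w} 𝕜} {g h : ballObj.{w} 𝕜 n ⟶ Z}
    (hgh : (ballMat.{w} 𝕜 n).map (lin g) = (ballMat.{w} 𝕜 n).map (lin h)) : g = h :=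
  gen_hom_ext _ _ _ fun ⟨(i, j)⟩ => congrFun (congrFun hgh i) j

end Ball

end OSp

/-! ### Order and norm in operator systems -/

namespace OperatorSystemStructure

section Sandwich

variable {𝕜 : Type} [RCLike 𝕜] {V : Type w} [AddCommGroup V] [Module 𝕜 V]

lemma sandwich_smul_one {ι : Type} [Fintype ι] [DecidableEq ι] (c d : 𝕜) (A : Matrix ι ι V) :
    sandwich (c • (1 : Matrix ι ι 𝕜)) A (d • (1 : Matrix ι ι 𝕜)) = (c * d) • A := by
  ext i j
  simp [sandwich, Matrix.one_apply, ite_smul]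

/-- Applied to [[c, a], [a*, c]], this change of basis puts 2c ± (a + a*) on the diagonal and ±(a -
a*) off it. The Hermitian and skew parts of a separate without dividing by i. -/
lemma sandwich_hadamard {ι : Type} [Fintype ι] [DecidableEq ι] (A B C D : Matrix ι ι V) :
    sandwich (Matrix.fromBlocks (1 : Matrix ι ι 𝕜) 1 1 (-1))ᴴ (Matrix.fromBlocks A B C D)
      (Matrix.fromBlocks (1 : Matrix ι ι 𝕜) 1 1 (-1)) =
      Matrix.fromBlocks (A + B + C + D) (A - B + C - D) (A + B - C - D) (A - B - C + D) := by
  ext (i | i) (j | j) <;>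
    simp [sandwich, Matrix.one_apply, ite_smul, apply_ite (Neg.neg : 𝕜 → 𝕜),
      apply_ite (starRingEnd 𝕜), Finset.sum_add_distrib] <;> abel

/-- Turns [[c, a], [a*, c]] ≥ 0 into 2c - a - a* ≥ 0, so that order inequalities can be read off
from norm bounds. -/
lemma sandwich_antidiagonal {ι : Type} [Fintype ι] [DecidableEq ι] (A B C D : Matrix ι ι V) :
    sandwich (Matrix.fromRows (1 : Matrix ι ι 𝕜) (-1 : Matrix ι ι 𝕜))ᴴ (Matrix.fromBlocks A B C D)
      (Matrix.fromRows (1 : Matrix ι ι 𝕜) (-1 : Matrix ι ι 𝕜)) = A - B - C + D := by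
  ext i j
  simp [sandwich, Matrix.one_apply, ite_smul, apply_ite (Neg.neg : 𝕜 → 𝕜),
    apply_ite (starRingEnd 𝕜), Finset.sum_add_distrib]
  abel

end Sandwich

variable {𝕜 : Type} [RCLike 𝕜] {V : Type w} [AddCommGroup V] [Module 𝕜 V] [StarAddMonoid V]
  [StarModule 𝕜 V] {S : OperatorSystemStructure 𝕜 V}

/-- Closure under scaling is not an axiom: it is conjugation by √r times the identity. -/
lemma Pos.smul {ι : Type} [Fintype ι] {A : Matrix ι ι V} (hA : S.Pos A) {r : ℝ} (hr : 0 ≤ r) :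
    S.Pos ((r : 𝕜) • A) := by
  classical
  have h := hA.conj (((Real.sqrt r : ℝ) : 𝕜) • (1 : Matrix ι ι 𝕜))
  rw [Matrix.conjTranspose_smul, Matrix.conjTranspose_one, sandwich_smul_one] at h
  simpa [← RCLike.ofReal_mul, Real.mul_self_sqrt hr] using h

lemma smul_mem {n : ℕ} {A : Matrix (Fin n) (Fin n) V} (hA : A ∈ S.cone n) {r : ℝ} (hr : 0 ≤ r) :
    (r : 𝕜) • A ∈ S.cone n :=
  (S.pos_fin _).mp (((S.pos_fin A).mpr hA).smul hr)

variable (S)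

lemma unit_mem {n : ℕ} {r : ℝ} (hr : 0 ≤ r) :
    (r : 𝕜) • Matrix.diagonal (fun _ => S.unit) ∈ S.cone n :=
  (S.pos_fin _).mp (S.pos_smul_unit (Fin n) hr)

lemma isHermitian_unit {n : Type} [DecidableEq n] (r : ℝ) :
    ((r : 𝕜) • Matrix.diagonal (fun _ : n => S.unit)).IsHermitian := by
  simp [Matrix.IsHermitian, Matrix.conjTranspose_smul, Matrix.diagonal_conjTranspose,
    Pi.star_def, S.star_unit]

variable {S}

lemma unit_sub_mem_of_bd {n : ℕ} {r : ℝ} {A : Matrix (Fin n) (Fin n) V} (hA : A.IsHermitian)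
    (h : S.Bd r A) : (r : 𝕜) • Matrix.diagonal (fun _ => S.unit) - A ∈ S.cone n := by
  have h1 := h.conj (Matrix.fromRows (1 : Matrix (Fin n) (Fin n) 𝕜) (-1 : Matrix (Fin n) (Fin n) 𝕜))
  rw [sandwich_antidiagonal, hA.eq, S.pos_fin] at h1
  have h2 := smul_mem h1 (r := 1 / 2) (by norm_num)
  convert h2 using 1
  have : ((1 / 2 : ℝ) : 𝕜) = (2 : 𝕜)⁻¹ := by push_cast; simp
  rw [this]
  module

/-- If the real part of `y` is positive then `‖1 - t y‖ ≤ 1 + C t ^ 2` for small `t > 0`. -/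
lemma exists_bd_unit_sub_smul {n : ℕ} (y : Matrix (Fin n) (Fin n) V) (hy : y + yᴴ ∈ S.cone n) :
    ∃ C δ : ℝ, 0 ≤ C ∧ 0 < δ ∧ ∀ t : ℝ, 0 < t → t ≤ δ →
      S.Bd (1 + C * t ^ 2) (Matrix.diagonal (fun _ => S.unit) - (t : 𝕜) • y) := by
  obtain ⟨β₀, hβ₀, hb₀⟩ := S.exists_bd (y - yᴴ)
  obtain ⟨β, hβ, hb⟩ : ∃ β : ℝ, 0 < β ∧ S.Bd β (y - yᴴ) :=
    -- Strict positivity is needed because √β is inverted below.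
    ⟨β₀ + 1, by linarith, S.bd_mono (by linarith) hb₀⟩
  obtain ⟨α, hα, ha⟩ := S.order_unit (y + yᴴ) (S.isHermitian_of_mem hy)
  -- Write h = y + y* and k = y - y*, so 1 - t y = (1 - t h/2) - t k/2. The bound t ≤ 2/α keeps 1 -
  -- t h/2 positive; β²/4 is the cost of the skew part k, as computed in `h3`.
  refine ⟨β ^ 2 / 4, 2 / α, by positivity, by positivity, fun t ht htδ => ?_⟩
  set E : Matrix (Fin n) (Fin n) V := Matrix.diagonal (fun _ => S.unit) with hE
  have htα : 0 ≤ 1 - t / 2 * α := by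
    rw [le_div_iff₀ hα] at htδ
    linarith
  have h1 : S.Pos (E - ((t / 2 : ℝ) : 𝕜) • (y + yᴴ)) := by
    have h1 := S.add_mem (S.unit_mem (n := n) htα) (smul_mem ha (r := t / 2) (by positivity))
    rw [S.pos_fin]
    convert h1 using 1
    push_cast
    module
  have h2 : S.Pos (((t / 2 : ℝ) : 𝕜) • (y + yᴴ)) :=
    (S.pos_fin _).mpr (smul_mem hy (by positivity))
  set s : ℝ := Real.sqrt β with hs
  have hs0 : 0 < s := Real.sqrt_pos.mpr hβ
  have hss : s * s = β := Real.mul_self_sqrt hβ.le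
  -- Rescaling [[β, k], [k*, β]] by diag(s⁻¹, t s/2) with s = √β gives [[1, t k/2], [t k*/2, β²
  -- t²/4]]: an off-diagonal term of order t costs only t² in one corner.
  have h3 := hb.conj (Matrix.fromBlocks (((s⁻¹ : ℝ) : 𝕜) • (1 : Matrix (Fin n) (Fin n) 𝕜)) 0 0
    (((t * s / 2 : ℝ) : 𝕜) • (1 : Matrix (Fin n) (Fin n) 𝕜)))
  rw [sandwich_fromBlocks] at h3
  simp only [Matrix.conjTranspose_smul, Matrix.conjTranspose_one, sandwich_smul_one,
    RCLike.star_def, RCLike.conj_ofReal, ← RCLike.ofReal_mul, smul_smul] at h3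
  have e1 : s⁻¹ * s⁻¹ * β = 1 := by rw [← hss]; field_simp
  have e2 : s⁻¹ * (t * s / 2) = t / 2 := by field_simp
  have e3 : t * s / 2 * s⁻¹ = t / 2 := by field_simp
  have e4 : t * s / 2 * (t * s / 2) * β = β ^ 2 / 4 * t ^ 2 := by
    rw [show t * s / 2 * (t * s / 2) = (s * s) * (t ^ 2 / 4) by ring, hss]; ring
  rw [e1, e2, e3, e4] at h3
  -- The added corner β² t²/4 makes the two error terms equal. After the Hadamard change of basis
  -- they cancel off the diagonal, leaving exactly 1 - t y after halving.
  have h4 := (Pos.fromBlocks S h1 h2).add (h3.add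
    (Pos.fromBlocks S (S.pos_smul_unit (Fin n) (r := β ^ 2 / 4 * t ^ 2) (by positivity))
      (S.pos_smul_unit (Fin n) (r := 0) le_rfl)))
  have h5 := (h4.conj (Matrix.fromBlocks (1 : Matrix (Fin n) (Fin n) 𝕜) (1 : Matrix (Fin n) (Fin n) 𝕜) 1 (-1))).smul
    (r := 1 / 2) (by norm_num)
  rw [Matrix.fromBlocks_add, Matrix.fromBlocks_add, sandwich_hadamard,
    Matrix.fromBlocks_smul] at h5
  unfold Bd
  convert h5 using 1
  have hc : (((1 / 2 : ℝ) : ℝ) : 𝕜) = (2 : 𝕜)⁻¹ := by push_cast; simp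
  have ht2 : ((t / 2 : ℝ) : 𝕜) = (2 : 𝕜)⁻¹ * (t : 𝕜) := by push_cast; ring
  have hEE : Eᴴ = E := by
    simp [hE, Matrix.diagonal_conjTranspose, Pi.star_def, S.star_unit]
  have hconj : (E - (t : 𝕜) • y)ᴴ = E - (t : 𝕜) • yᴴ := by
    rw [Matrix.conjTranspose_sub, Matrix.conjTranspose_smul, hEE]
    simp
  rw [hconj, hc, ht2]
  simp only [← hE, Matrix.conjTranspose_sub, Matrix.conjTranspose_conjTranspose]
  push_cast
  congr 1 <;> module

/-- If `‖1 - t y‖ ≤ 1 + C t ^ 2` for small `t > 0` then the real part of `y` is positive. -/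
lemma add_conjTranspose_mem_of_bd {n : ℕ} (y : Matrix (Fin n) (Fin n) V) {C δ : ℝ} (hC : 0 ≤ C)
    (hδ : 0 < δ) (h : ∀ t : ℝ, 0 < t → t ≤ δ →
      S.Bd (1 + C * t ^ 2) (Matrix.diagonal (fun _ => S.unit) - (t : 𝕜) • y)) :
    y + yᴴ ∈ S.cone n := by
  refine S.archimedean _ (Matrix.isHermitian_add_transpose_self y) fun r hr => ?_
  -- Compression by (1, -1) will give t (y + y*) + 2 C t² ≥ 0, so after division by t it suffices
  -- that 2 C t ≤ r. The summand 1 in the denominator covers C = 0.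
  set t : ℝ := min δ (r / (2 * C + 1)) with ht
  have ht0 : 0 < t := lt_min hδ (by positivity)
  have htr : 0 ≤ r - 2 * C * t := by
    have : t * (2 * C + 1) ≤ r := by
      rw [← le_div_iff₀ (by positivity)]; exact min_le_right _ _
    nlinarith
  have h1 := (h t ht0 (min_le_left _ _)).conj
    (Matrix.fromRows (1 : Matrix (Fin n) (Fin n) 𝕜) (-1 : Matrix (Fin n) (Fin n) 𝕜))
  rw [sandwich_antidiagonal, S.pos_fin] at h1
  have h2 := S.add_mem (smul_mem h1 (inv_nonneg.mpr ht0.le)) (S.unit_mem (n := n) htr)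
  convert h2 using 1
  set E : Matrix (Fin n) (Fin n) V := Matrix.diagonal (fun _ => S.unit) with hE
  have hEE : Eᴴ = E := by
    simp [hE, Matrix.diagonal_conjTranspose, Pi.star_def, S.star_unit]
  have hconj : (E - (t : 𝕜) • y)ᴴ = E - (t : 𝕜) • yᴴ := by
    rw [Matrix.conjTranspose_sub, Matrix.conjTranspose_smul, hEE]
    simp
  have htt : (t : 𝕜) ≠ 0 := by exact_mod_cast ht0.ne'
  rw [hconj]
  push_cast
  match_scalars <;> field_simp
  ring

end OperatorSystemStructure

/-! ### Morphisms of operator systems -/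

namespace OSys

variable {𝕜 : Type} [RCLike 𝕜]

/-- The linear map underlying a morphism. -/
abbrev lin {S T : OSys.{w} 𝕜} (f : S ⟶ T) : S →ₗ[𝕜] T := Hom.toLin f

lemma hom_ext {S T : OSys.{w} 𝕜} {f g : S ⟶ T} (h : ∀ x, lin f x = lin g x) : f = g :=
  Hom.ext (LinearMap.ext h)

lemma lin_unit {S T : OSys.{w} 𝕜} (f : S ⟶ T) : lin f S.str.unit = T.str.unit :=
  Hom.map_unit f

lemma map_mem_cone {S T : OSys.{w} 𝕜} (f : S ⟶ T) {n : ℕ} {A : Matrix (Fin n) (Fin n) S}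
    (hA : A ∈ S.str.cone n) : A.map (lin f) ∈ T.str.cone n :=
  Hom.completelyPositive f n A hA

lemma map_diagonal_unit {S T : OSys.{w} 𝕜} {f : S →ₗ[𝕜] T} (hf : f S.str.unit = T.str.unit)
    (c : 𝕜) (ι : Type) [DecidableEq ι] :
    (c • Matrix.diagonal (fun _ : ι => S.str.unit)).map f =
      c • Matrix.diagonal (fun _ : ι => T.str.unit) := by
  ext i j
  by_cases h : i = j <;> simp [h, hf]

/-- Preservation of the involution is not assumed of a morphism. It holds because x and x* are
opposite corners of a positive matrix, whose image is positive and therefore Hermitian. -/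
lemma lin_star {S T : OSys.{w} 𝕜} (f : S ⟶ T) (x : S) : lin f (star x) = star (lin f x) := by
  obtain ⟨r, _, h⟩ := S.str.exists_bd (Matrix.of fun (_ _ : Fin 1) => x)
  have h1 := T.str.isHermitian_of_mem (map_mem_cone f ((S.str.normBlock_mem_iff _ _).mpr h))
  have h2 := h1.apply (finSumFinEquiv (Sum.inr 0)) (finSumFinEquiv (Sum.inl 0))
  simpa [OperatorSystemStructure.normBlock, block, -finSumFinEquiv_apply_left,
    -finSumFinEquiv_apply_right] using h2.symm

lemma map_conjTranspose {S T : OSys.{w} 𝕜} (f : S ⟶ T) {ι κ : Type} (A : Matrix ι κ S) :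
    Aᴴ.map (lin f) = (A.map (lin f))ᴴ := by
  ext i j
  exact lin_star f _

/-- A unital completely contractive map of operator systems preserves the cones. -/
lemma map_mem_cone_of_contractive {S T : OSys.{w} 𝕜} (f : S →ₗ[𝕜] T)
    (hunit : f S.str.unit = T.str.unit)
    (hf : ∀ (n : ℕ) (A : Matrix (Fin n) (Fin n) S),
      T.str.normFun n (A.map f) ≤ S.str.normFun n A)
    {n : ℕ} {A : Matrix (Fin n) (Fin n) S} (hA : A ∈ S.str.cone n) :
    A.map f ∈ T.str.cone n := by
  -- Positivity of the real part passes through its metric description, which involves only the norm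
  -- and the unit.
  have key : ∀ {m : ℕ} (y : Matrix (Fin m) (Fin m) S), y + yᴴ ∈ S.str.cone m →
      y.map f + (y.map f)ᴴ ∈ T.str.cone m := by
    intro m y hy
    obtain ⟨C, δ, hC, hδ, h⟩ := OperatorSystemStructure.exists_bd_unit_sub_smul y hy
    refine OperatorSystemStructure.add_conjTranspose_mem_of_bd (y.map f) hC hδ
      fun t ht htδ => ?_
    have hr : 0 ≤ 1 + C * t ^ 2 := by positivity
    have h1 := (hf m _).trans ((S.str.normFun_le_iff_bd hr _).mpr (h t ht htδ))
    rw [T.str.normFun_le_iff_bd hr] at h1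
    convert h1 using 1
    ext i j
    by_cases hij : i = j <;> simp [hij, hunit]
  have hAh := S.str.isHermitian_of_mem hA
  have h1 := key A (by rw [hAh.eq]; exact S.str.add_mem hA hA)
  -- The cone element y = A gives only f(A) + f(A)* ≥ 0; it remains to see that f(A) is Hermitian.
  -- The matrix [[0, -A], [A, 0]] and its negative have zero real part, so the real part of the
  -- image is positive and negative, hence zero.
  have hskew : ∀ B : Matrix (Fin n) (Fin n) S, B.IsHermitian →
      block 0 (-B) B 0 + (block 0 (-B) B 0)ᴴ = 0 := by
    intro B hB
    ext i j
    obtain ⟨i, rfl⟩ := finSumFinEquiv.surjective i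
    obtain ⟨j, rfl⟩ := finSumFinEquiv.surjective j
    have hB' := hB.apply
    rcases i with i | i <;> rcases j with j | j <;>
      simp [block, hB', -finSumFinEquiv_apply_left, -finSumFinEquiv_apply_right]
  have h2 := key (block 0 (-A) A 0) (by rw [hskew A hAh]; exact S.str.zero_mem _)
  have h3 := key (block 0 (-(-A)) (-A) 0) (by rw [hskew _ hAh.neg]; exact S.str.zero_mem _)
  have h4 := T.str.eq_zero_of_mem h2 (by
    convert h3 using 1
    simp only [map_block]
    ext i j
    obtain ⟨i, rfl⟩ := finSumFinEquiv.surjective i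
    obtain ⟨j, rfl⟩ := finSumFinEquiv.surjective j
    rcases i with i | i <;> rcases j with j | j <;>
      simp [block, add_comm, -finSumFinEquiv_apply_left, -finSumFinEquiv_apply_right])
  have h5 : (A.map f)ᴴ = A.map f := by
    ext i j
    have := congrFun (congrFun h4 (finSumFinEquiv (Sum.inl i))) (finSumFinEquiv (Sum.inr j))
    simp [block, -finSumFinEquiv_apply_left, -finSumFinEquiv_apply_right] at this
    rw [neg_add_eq_zero] at this
    simpa using this.symm
  rw [h5] at h1
  have h6 := OperatorSystemStructure.smul_mem h1 (r := 1 / 2) (by norm_num)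
  convert h6 using 1
  have : ((1 / 2 : ℝ) : 𝕜) = (2 : 𝕜)⁻¹ := by push_cast; simp
  rw [this]
  module

/-- The morphism of operator systems given by a unital completely contractive map. -/
def homOfUnital {S T : OSys.{w} 𝕜} (f : (forgetToOSp 𝕜).obj S ⟶ (forgetToOSp 𝕜).obj T)
    (hf : OSp.lin f S.str.unit = T.str.unit) : S ⟶ T :=
  Hom.mk (OSp.lin f) hf fun _ _ hA =>
    map_mem_cone_of_contractive (OSp.lin f) hf (fun _ A => OSp.matNorm_map_le f A) hA

instance : (forgetToOSp.{w} 𝕜).Faithful where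
  map_injective {S T} _ _ h := hom_ext fun x =>
    congrArg (fun k : (forgetToOSp 𝕜).obj S ⟶ (forgetToOSp 𝕜).obj T => OSp.lin k x) h

lemma exists_forgetToOSp_map_eq_iff {S T : OSys.{w} 𝕜}
    (f : (forgetToOSp 𝕜).obj S ⟶ (forgetToOSp 𝕜).obj T) :
    (∃ g : S ⟶ T, (forgetToOSp 𝕜).map g = f) ↔ OSp.lin f S.str.unit = T.str.unit := by
  constructor
  · rintro ⟨g, rfl⟩
    exact lin_unit g
  · intro h
    exact ⟨homOfUnital f h, rfl⟩

/-- The inverse complete contraction sends unit to unit, hence is itself a morphism of operator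
systems. -/
instance : (forgetToOSp.{w} 𝕜).ReflectsIsomorphisms where
  reflects {S T} f _ := by
    have h1 : ∀ x, OSp.lin (inv ((forgetToOSp 𝕜).map f)) (lin f x) = x := fun x =>
      congrArg (fun k : (forgetToOSp 𝕜).obj S ⟶ (forgetToOSp 𝕜).obj S => OSp.lin k x)
        (IsIso.hom_inv_id ((forgetToOSp 𝕜).map f))
    obtain ⟨g, hg⟩ := (exists_forgetToOSp_map_eq_iff (inv ((forgetToOSp 𝕜).map f))).mpr
      ((congrArg _ (lin_unit f).symm).trans (h1 _))
    exact ⟨g, (forgetToOSp 𝕜).map_injective (by simp [hg]),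
      (forgetToOSp 𝕜).map_injective (by simp [hg])⟩

end OSys

/-! ### Norms of adjoints and of the order unit. -/

lemma OperatorSystemStructure.bd_conjTranspose {𝕜 : Type} [RCLike 𝕜] {V : Type w}
    [AddCommGroup V] [Module 𝕜 V] [StarAddMonoid V] [StarModule 𝕜 V]
    {S : OperatorSystemStructure 𝕜 V} {n : ℕ} {r : ℝ} {A : Matrix (Fin n) (Fin n) V}
    (h : S.Bd r A) : S.Bd r Aᴴ := by
  have := h.submatrix (Sum.swap : Fin n ⊕ Fin n → Fin n ⊕ Fin n)
  unfold Bd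
  convert this using 1
  ext (i | i) (j | j) <;> simp

lemma OperatorSystemStructure.norm₁_star_le {𝕜 : Type} [RCLike 𝕜] {V : Type w}
    [AddCommGroup V] [Module 𝕜 V] [StarAddMonoid V] [StarModule 𝕜 V]
    (S : OperatorSystemStructure 𝕜 V) (v : V) :
    S.toOperatorSpaceStructure.norm₁ (star v) ≤ S.toOperatorSpaceStructure.norm₁ v :=
  (S.normFun_le_iff_bd (S.normFun_nonneg _ _) _).mpr
    (bd_conjTranspose (S.bd_normFun 1 (Matrix.of fun _ _ => v)))

lemma OperatorSystemStructure.norm₁_unit_le {𝕜 : Type} [RCLike 𝕜] {V : Type w}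
    [AddCommGroup V] [Module 𝕜 V] [StarAddMonoid V] [StarModule 𝕜 V]
    (S : OperatorSystemStructure 𝕜 V) : S.toOperatorSpaceStructure.norm₁ S.unit ≤ 1 := by
  refine (S.normFun_le_iff_bd zero_le_one _).mpr ?_
  -- The matrix [[e, e], [e, e]] is positive because it is obtained from the 1 × 1 matrix e by
  -- repeating its index.
  have := (S.pos_unit (Fin 1)).submatrix (fun _ : Fin 1 ⊕ Fin 1 => 0)
  unfold Bd
  convert this using 1
  ext (i | i) (j | j) <;> simp [Subsingleton.elim i j, S.star_unit]

/-! ### Operator systems defined by families of linear maps -/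

namespace OSys

variable {𝕜 : Type} [RCLike 𝕜]

section Initial

variable {V : Type w} [AddCommGroup V] [Module 𝕜 V] [StarAddMonoid V] [StarModule 𝕜 V]
  {I : Type u} (Z : I → OSys.{w} 𝕜) (φ : ∀ i, V →ₗ[𝕜] Z i) (e : V)

/-- The operator system structure defined by a pointwise bounded, jointly injective family of
unital `*`-linear maps to operator systems: an element is positive if all its images are. -/
def initialStructure
    (hb : ∀ v, ∃ r, ∀ i, (Z i).str.toOperatorSpaceStructure.norm₁ (φ i v) ≤ r)
    (hinj : ∀ v, (∀ i, φ i v = 0) → v = 0) (hstar : ∀ i v, φ i (star v) = star (φ i v))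
    (he : ∀ i, φ i e = (Z i).str.unit) : OperatorSystemStructure 𝕜 V where
  cone n := {A | ∀ i, A.map (φ i) ∈ (Z i).str.cone n}
  unit := e
  isHermitian_of_mem {n A} hA := by
    ext a b
    rw [← sub_eq_zero]
    refine hinj _ fun i => ?_
    have := ((Z i).str.isHermitian_of_mem (hA i)).apply a b
    rw [map_sub, sub_eq_zero, Matrix.conjTranspose_apply, hstar]
    exact this
  zero_mem n i := by
    rw [Matrix.map_zero _ (map_zero (φ i))]
    exact (Z i).str.zero_mem n
  add_mem hA hB i := by
    rw [Matrix.map_add _ (map_add (φ i))]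
    exact (Z i).str.add_mem (hA i) (hB i)
  conj_mem X hA i := by
    rw [map_sandwich]
    exact (Z i).str.conj_mem X (hA i)
  eq_zero_of_mem {n A} hA hA' := by
    ext a b
    refine hinj _ fun i => ?_
    refine congrFun (congrFun ((Z i).str.eq_zero_of_mem (hA i) ?_) a) b
    have : (-A).map (φ i) = -(A.map (φ i)) := by ext; simp
    exact this ▸ hA' i
  star_unit := by
    rw [← sub_eq_zero]
    refine hinj _ fun i => ?_
    rw [map_sub, hstar, he, (Z i).str.star_unit, sub_self]
  order_unit {n} A hA := by
    choose r hr using hb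
    have h0 : 0 ≤ ∑ a, ∑ b, |r (A a b)| := by positivity
    -- A uniform norm bound for the images gives a uniform order bound. Absolute values are needed
    -- because a bound may be negative when there are no tests; the summand 1 makes the constant
    -- positive.
    refine ⟨∑ a, ∑ b, |r (A a b)| + 1, by positivity, fun i => ?_⟩
    have h1 : (Z i).str.normFun n (A.map (φ i)) ≤ ∑ a, ∑ b, |r (A a b)| + 1 :=
      ((Z i).str.toOperatorSpaceStructure.matNorm_le_sum _).trans
        ((Finset.sum_le_sum fun a _ => Finset.sum_le_sum fun b _ =>
          (hr _ i).trans (le_abs_self _)).trans (le_add_of_nonneg_right zero_le_one))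
    rw [(Z i).str.normFun_le_iff_bd (by positivity)] at h1
    have h2 := OperatorSystemStructure.unit_sub_mem_of_bd (by
      ext a b
      have := congrArg (φ i) (hA.apply a b)
      rwa [hstar] at this) h1
    convert h2 using 1
    ext a b
    by_cases hab : a = b <;> simp [hab, he]
  archimedean {n} A hA h i := by
    refine (Z i).str.archimedean _ ?_ fun r hr => ?_
    · ext a b
      have := congrArg (φ i) (hA.apply a b)
      rwa [hstar] at this
    · convert h r hr i using 1
      ext a b
      by_cases hab : a = b <;> simp [hab, he]

end Initial

/-! ### Operator systems generated by a set, subject to a family of test maps -/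

section Generated

variable {X : Type w} {I : Type u} (Z : I → OSys.{w} 𝕜) (f : ∀ i, X → Z i)

/-- The map on the set of formal generators: the elements of `X`, their adjoints, and the unit. -/
def testFun (i : I) : Option (X ⊕ X) → Z i
  | none => (Z i).str.unit
  | some (Sum.inl x) => f i x
  | some (Sum.inr x) => star (f i x)

/-- The vector space generated by the formal generators. -/
abbrev GenSpace : Type w :=
  (Option (X ⊕ X) →₀ 𝕜) ⧸ OSp.testKernel (fun i => (forgetToOSp 𝕜).obj (Z i)) (testFun Z f)

/-- The linear map induced by a test map. -/
def genMap (i : I) : GenSpace Z f →ₗ[𝕜] Z i :=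
  OSp.testMap (fun i => (forgetToOSp 𝕜).obj (Z i)) (testFun Z f) i

/-- The image of a formal generator. -/
def formalGen (x : Option (X ⊕ X)) : GenSpace Z f :=
  OSp.testGen (fun i => (forgetToOSp 𝕜).obj (Z i)) (testFun Z f) x

lemma genMap_formalGen (i : I) (x : Option (X ⊕ X)) :
    genMap Z f i (formalGen Z f x) = testFun Z f i x :=
  OSp.testMap_testGen _ _ i x

lemma genMap_injective {v v' : GenSpace Z f} (h : ∀ i, genMap Z f i v = genMap Z f i v') :
    v = v' :=
  sub_eq_zero.mp (OSp.testMap_injective _ _ _ fun i => by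
    have := h i
    rw [← sub_eq_zero, ← map_sub] at this
    exact this)

/-- The adjoint swaps the two copies of X, fixes the unit and conjugates coefficients. Existence
suffices to define it, since joint injectivity of the tests makes it unique. -/
lemma exists_star (v : GenSpace Z f) : ∃ v', ∀ i, genMap Z f i v' = star (genMap Z f i v) := by
  induction v using OSp.testGen_induction with
  | zero => exact ⟨0, fun i => by simp⟩
  | add v v' h h' =>
    obtain ⟨u, hu⟩ := h
    obtain ⟨u', hu'⟩ := h'
    exact ⟨u + u', fun i => by simp [hu, hu']⟩
  | smul c x =>
    change ∃ v', ∀ i, genMap Z f i v' = star (genMap Z f i (c • formalGen Z f x))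
    rcases x with _ | x | x
    · refine ⟨star c • formalGen Z f none, fun i => ?_⟩
      rw [map_smul, map_smul, star_smul]
      simp only [genMap_formalGen]
      exact congrArg _ (Z i).str.star_unit.symm
    · refine ⟨star c • formalGen Z f (some (Sum.inr x)), fun i => ?_⟩
      rw [map_smul, map_smul, star_smul]
      simp only [genMap_formalGen]
      rfl
    · refine ⟨star c • formalGen Z f (some (Sum.inl x)), fun i => ?_⟩
      rw [map_smul, map_smul, star_smul]
      simp only [genMap_formalGen]
      exact congrArg _ (star_star (f i x)).symm

/-- The involution on the generated vector space. -/
instance : Star (GenSpace Z f) := ⟨fun v => (exists_star Z f v).choose⟩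

lemma genMap_star (i : I) (v : GenSpace Z f) : genMap Z f i (star v) = star (genMap Z f i v) :=
  (exists_star Z f v).choose_spec i

instance : StarAddMonoid (GenSpace Z f) where
  star_involutive v := genMap_injective Z f fun i => by simp [genMap_star]
  star_add v v' := genMap_injective Z f fun i => by simp [genMap_star]

instance : StarModule 𝕜 (GenSpace Z f) where
  star_smul c v := genMap_injective Z f fun i => by simp [genMap_star]

variable (hb : ∀ x, ∃ r, ∀ i, (Z i).str.toOperatorSpaceStructure.norm₁ (f i x) ≤ r)

include hb in
lemma testFun_bounded (x : Option (X ⊕ X)) :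
    ∃ r, ∀ i, (Z i).str.toOperatorSpaceStructure.norm₁ (testFun Z f i x) ≤ r := by
  rcases x with _ | x | x
  · exact ⟨1, fun i => (Z i).str.norm₁_unit_le⟩
  · exact hb x
  · obtain ⟨r, hr⟩ := hb x
    exact ⟨r, fun i => ((Z i).str.norm₁_star_le _).trans (hr i)⟩

/-- The operator system generated by a set `X`, with the largest cones for which all the
test maps `f i : X → Z i` extend to unital completely positive maps. -/
def generated : OSys.{w} 𝕜 where
  carrier := GenSpace Z f
  str := initialStructure Z (genMap Z f) (formalGen Z f none)
    (OSp.testMap_bounded (fun i => (forgetToOSp 𝕜).obj (Z i)) (testFun Z f)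
      (testFun_bounded Z f hb))
    (OSp.testMap_injective _ _) (genMap_star Z f) (fun i => genMap_formalGen Z f i none)

/-- The generators of a generated operator system. -/
def gen (x : X) : generated Z f hb := formalGen Z f (some (Sum.inl x))

/-- The extension of a test map to the generated operator system. -/
def genDesc (i : I) : generated Z f hb ⟶ Z i :=
  Hom.mk (genMap Z f i) (genMap_formalGen Z f i none) fun _ _ hA => hA i

@[simp]
lemma genDesc_gen (i : I) (x : X) : lin (genDesc Z f hb i) (gen Z f hb x) = f i x :=
  genMap_formalGen Z f i _

lemma eq_of_genDesc {v v' : generated Z f hb}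
    (h : ∀ i, lin (genDesc Z f hb i) v = lin (genDesc Z f hb i) v') : v = v' :=
  genMap_injective Z f h

/-- The unit and the formal adjoints also span, but morphisms preserve unit and adjoints, so the
values on X decide. -/
lemma gen_hom_ext {Y : OSys.{w} 𝕜} {g h : generated Z f hb ⟶ Y}
    (hgh : ∀ x, lin g (gen Z f hb x) = lin h (gen Z f hb x)) : g = h := by
  refine Hom.ext (OSp.testGen_hom_ext _ _ fun x => ?_)
  rcases x with _ | x | x
  · exact (lin_unit g).trans (lin_unit h).symm
  · exact hgh x
  · have hx : formalGen Z f (some (Sum.inr x)) = star (gen Z f hb x) :=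
      eq_of_genDesc Z f hb fun i => by
        rw [lin_star, genDesc_gen]
        exact genMap_formalGen Z f i _
    have h1 : lin g (star (gen Z f hb x)) = lin h (star (gen Z f hb x)) := by
      rw [lin_star, lin_star, hgh]
    rw [← hx] at h1
    exact h1

lemma mem_generated_cone {n : ℕ} {A : Matrix (Fin n) (Fin n) (generated Z f hb)}
    (h : ∀ i, A.map (lin (genDesc Z f hb i)) ∈ (Z i).str.cone n) :
    A ∈ (generated Z f hb).str.cone n :=
  h

end Generated

lemma map_normBlock {S T : OSys.{w} 𝕜} (f : S ⟶ T) {n : ℕ} (r : ℝ)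
    (A : Matrix (Fin n) (Fin n) S) :
    (S.str.normBlock r A).map (lin f) = T.str.normBlock r (A.map (lin f)) := by
  unfold OperatorSystemStructure.normBlock
  rw [map_block, map_conjTranspose, map_diagonal_unit (lin_unit f)]

/-- A norm bound is the positivity of a block matrix built from unit and adjoints, and positivity is
decided by the tests. -/
lemma generated_normFun_le {X : Type w} {I : Type u} (Z : I → OSys.{w} 𝕜) (f : ∀ i, X → Z i)
    (hb : ∀ x, ∃ r, ∀ i, (Z i).str.toOperatorSpaceStructure.norm₁ (f i x) ≤ r) {n : ℕ}
    {A : Matrix (Fin n) (Fin n) (generated Z f hb)} {r : ℝ} (hr : 0 ≤ r)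
    (h : ∀ i, (Z i).str.normFun n (A.map (lin (genDesc Z f hb i))) ≤ r) :
    (generated Z f hb).str.normFun n A ≤ r := by
  rw [OperatorSystemStructure.normFun_le_iff _ hr]
  refine mem_generated_cone Z f hb fun i => ?_
  rw [map_normBlock]
  exact ((Z i).str.normFun_le_iff hr _).mp (h i)

/-! ### Colimits of operator systems -/

section Colimits

variable {J : Type w} [SmallCategory J] (F : J ⥤ OSys.{w} 𝕜)

lemma lin_cocone_w (s : Cocone F) {i j : J} (g : i ⟶ j) (x : F.obj i) :
    lin (s.ι.app j) (lin (F.map g) x) = lin (s.ι.app i) x :=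
  congrArg (fun h : F.obj i ⟶ s.pt => lin h x) (s.w g)

lemma cocone_bounded (x : Σ j, F.obj j) :
    ∃ r, ∀ s : Cocone F,
      s.pt.str.toOperatorSpaceStructure.norm₁ (lin (s.ι.app x.1) x.2) ≤ r :=
  ⟨_, fun s => OSp.norm₁_map_le ((forgetToOSp 𝕜).map (s.ι.app x.1)) x.2⟩

/-- The colimit of a diagram of operator systems. -/
abbrev colimitObj : OSys.{w} 𝕜 :=
  generated (X := Σ j, F.obj j) (I := Cocone F) (fun s => s.pt)
    (fun s x => lin (s.ι.app x.1) x.2) (cocone_bounded F)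

/-- The map from the colimit to the apex of a cocone. -/
abbrev colimitDesc (s : Cocone F) : colimitObj F ⟶ s.pt :=
  genDesc (X := Σ j, F.obj j) (I := Cocone F) (fun s => s.pt)
    (fun s x => lin (s.ι.app x.1) x.2) (cocone_bounded F) s

/-- The image in the colimit of an element of an object of the diagram. -/
abbrev colimitGen (j : J) (x : F.obj j) : colimitObj F :=
  gen (X := Σ j, F.obj j) (I := Cocone F) (fun s => s.pt)
    (fun s x => lin (s.ι.app x.1) x.2) (cocone_bounded F) ⟨j, x⟩

lemma colimitDesc_gen (s : Cocone F) (j : J) (x : F.obj j) :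
    lin (colimitDesc F s) (colimitGen F j x) = lin (s.ι.app j) x :=
  genDesc_gen _ _ _ s _

lemma eq_of_colimitDesc {v v' : colimitObj F}
    (h : ∀ s, lin (colimitDesc F s) v = lin (colimitDesc F s) v') : v = v' :=
  eq_of_genDesc _ _ _ h

/-- The colimit cocone of a diagram of operator systems. -/
def colimitCocone : Cocone F where
  pt := colimitObj F
  ι :=
    { app j := Hom.mk
        { toFun := colimitGen F j
          map_add' x y := eq_of_colimitDesc F fun s => by simp only [map_add, colimitDesc_gen]
          map_smul' c x := eq_of_colimitDesc F fun s => by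
            simp only [map_smul, colimitDesc_gen, RingHom.id_apply] }
        (eq_of_colimitDesc F fun s => (colimitDesc_gen F s j _).trans
          ((lin_unit (s.ι.app j)).trans (lin_unit (colimitDesc F s)).symm))
        fun n A hA => mem_generated_cone _ _ (cocone_bounded F) fun s =>
          (congrArg (· ∈ s.pt.str.cone n) (Matrix.ext fun _ _ => colimitDesc_gen F s j _)).mpr
            (map_mem_cone (s.ι.app j) hA)
      naturality i j g := hom_ext fun x => eq_of_colimitDesc F fun s =>
        (colimitDesc_gen F s j _).trans
          ((lin_cocone_w F s g x).trans (colimitDesc_gen F s i x).symm) }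

/-- The colimit cocone is a colimit. -/
def colimitCoconeIsColimit : IsColimit (colimitCocone F) where
  desc s := colimitDesc F s
  fac s j := hom_ext fun x => colimitDesc_gen F s j x
  uniq s _ hm := gen_hom_ext _ _ _ fun ⟨j, x⟩ =>
    (congrArg (fun h : F.obj j ⟶ s.pt => lin h x) (hm j)).trans (colimitDesc_gen F s j x).symm

end Colimits

instance : HasColimitsOfSize.{w, w} (OSys.{w} 𝕜) where
  has_colimits_of_shape _ _ := ⟨fun F => ⟨⟨⟨colimitCocone F, colimitCoconeIsColimit F⟩⟩⟩⟩

/-! ### The left adjoint of the forgetful functor -/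

section Free

variable (E : OSp.{w} 𝕜)

/-- The complete contractions from an operator space to operator systems. -/
abbrev FreeTest := Σ S : OSys.{w} 𝕜, E ⟶ (forgetToOSp 𝕜).obj S

variable {E} in
/-- The linear map underlying a test. -/
def FreeTest.map (t : FreeTest E) : E →ₗ[𝕜] t.1 := OSp.lin t.2

lemma freeTest_bounded (x : E) : ∃ r, ∀ t : FreeTest E,
    t.1.str.toOperatorSpaceStructure.norm₁ (t.map x) ≤ r :=
  ⟨_, fun t => OSp.norm₁_map_le t.2 x⟩

/-- The operator system freely generated by an operator space. -/
abbrev freeObj : OSys.{w} 𝕜 :=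
  generated (I := FreeTest E) (fun t => t.1) (fun t => t.map) (freeTest_bounded E)

/-- The extension of a complete contraction to the free operator system. -/
abbrev freeDesc (t : FreeTest E) : freeObj E ⟶ t.1 :=
  genDesc (I := FreeTest E) (fun t => t.1) (fun t => t.map) (freeTest_bounded E) t

/-- The inclusion of an operator space in the free operator system. -/
def freeLin : E →ₗ[𝕜] freeObj E where
  toFun x := gen (I := FreeTest E) (fun t => t.1) (fun t => t.map) (freeTest_bounded E) x
  map_add' x y := eq_of_genDesc _ _ (freeTest_bounded E) fun t => by
    simp only [map_add, genDesc_gen]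
  map_smul' c x := eq_of_genDesc _ _ (freeTest_bounded E) fun t => by
    simp only [map_smul, genDesc_gen, RingHom.id_apply]

/-- The universal complete contraction. -/
def freeUnit : E ⟶ (forgetToOSp 𝕜).obj (freeObj E) :=
  OSp.Hom.mk (freeLin E)
    fun n A => generated_normFun_le _ _ (freeTest_bounded E) (apply_nonneg _ _) fun t => by
      refine le_of_eq_of_le (congrArg _ ?_) (OSp.matNorm_map_le t.2 A)
      ext a b
      exact genDesc_gen (I := FreeTest E) _ _ (freeTest_bounded E) t _

lemma freeDesc_freeUnit (t : FreeTest E) (x : E) :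
    lin (freeDesc E t) (OSp.lin (freeUnit E) x) = t.map x :=
  genDesc_gen (I := FreeTest E) _ _ (freeTest_bounded E) t x

/-- Morphisms from the free operator system are complete contractions. -/
def freeHomEquiv (S : OSys.{w} 𝕜) : (freeObj E ⟶ S) ≃ (E ⟶ (forgetToOSp 𝕜).obj S) where
  toFun g := freeUnit E ≫ (forgetToOSp 𝕜).map g
  invFun h := freeDesc E ⟨S, h⟩
  left_inv _ := gen_hom_ext _ _ _ fun x => freeDesc_freeUnit E _ x
  right_inv _ := OSp.hom_ext fun x => freeDesc_freeUnit E _ x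

end Free

instance : (forgetToOSp.{w} 𝕜).IsRightAdjoint :=
  (Adjunction.adjunctionOfEquivLeft (G := forgetToOSp.{w} 𝕜) freeHomEquiv
    fun _ _ _ _ _ => rfl).isRightAdjoint

end OSys

/-! ### Filtered colimits of vector spaces -/

lemma hasCardinalLT_aleph_one_of_countable (K : Type u) [Countable K] :
    HasCardinalLT K (Cardinal.aleph.{w} 1) := by
  unfold HasCardinalLT
  refine lt_of_le_of_lt (b := Cardinal.aleph0) (by simp) ?_
  rw [← Cardinal.lift_aleph0.{u, w}, Cardinal.lift_lt]
  exact Cardinal.aleph0_lt_aleph_one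

section LinColimit

variable {𝕜 : Type} [RCLike 𝕜] {J : Type w} [SmallCategory J]

/-- The maps `ι j : M j → V` exhibit the set `V` as the filtered colimit of the vector
spaces `M j`. -/
structure IsLinColimit {M : J → Type w} [∀ j, AddCommGroup (M j)] [∀ j, Module 𝕜 (M j)]
    {V : Type w} [AddCommGroup V] [Module 𝕜 V] (tr : ∀ ⦃i j : J⦄, (i ⟶ j) → M i →ₗ[𝕜] M j)
    (ι : ∀ j, M j →ₗ[𝕜] V) : Prop where
  tr_comp {i j k : J} (g : i ⟶ j) (g' : j ⟶ k) (x : M i) : tr (g ≫ g') x = tr g' (tr g x)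
  ι_tr {i j : J} (g : i ⟶ j) (x : M i) : ι j (tr g x) = ι i x
  exists_rep (v : V) : ∃ j x, ι j x = v
  exists_eq {j : J} (x y : M j) : ι j x = ι j y → ∃ (k : J) (g : j ⟶ k), tr g x = tr g y

namespace IsLinColimit

lemma exists_of_isFiltered [IsFiltered J] (D : J ⥤ ModuleCat.{w} 𝕜) :
    ∃ (V : Type w) (_ : AddCommGroup V) (_ : Module 𝕜 V) (ι : ∀ j, D.obj j →ₗ[𝕜] V),
      IsLinColimit (fun _ _ g => (D.map g).hom) ι := by
  have : PreservesColimit D (forget (ModuleCat.{w} 𝕜)) :=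
    inferInstanceAs (PreservesColimit D
      (forget₂ (ModuleCat.{w} 𝕜) AddCommGrpCat.{w} ⋙ forget AddCommGrpCat.{w}))
  refine ⟨(colimit D : ModuleCat.{w} 𝕜), inferInstance, inferInstance, fun j => (colimit.ι D j).hom, ?_, ?_, ?_, ?_⟩
  · intro i j k g g' x
    simp
  · intro i j g x
    exact ConcreteCategory.congr_hom (colimit.w D g) x
  · intro v
    exact Concrete.isColimit_exists_rep D (colimit.isColimit D) v
  · intro j x y h
    obtain ⟨k, f, g, hk⟩ := Concrete.isColimit_exists_of_rep_eq D (colimit.isColimit D) x y h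
    -- The two elements become equal along possibly different arrows `f` and `g`, which are then
    -- coequalized.
    refine ⟨IsFiltered.coeq f g, f ≫ IsFiltered.coeqHom f g, ?_⟩
    have e : ∀ (p : j ⟶ k) (z : D.obj j), D.map (p ≫ IsFiltered.coeqHom f g) z =
        D.map (IsFiltered.coeqHom f g) (D.map p z) := fun p z => by simp
    exact (e f x).trans ((congrArg _ hk).trans ((e g y).symm.trans
      (by rw [IsFiltered.coeq_condition])))

variable {M : J → Type w} [∀ j, AddCommGroup (M j)] [∀ j, Module 𝕜 (M j)]
  {V : Type w} [AddCommGroup V] [Module 𝕜 V] {tr : ∀ ⦃i j : J⦄, (i ⟶ j) → M i →ₗ[𝕜] M j}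
  {ι : ∀ j, M j →ₗ[𝕜] V} (h : IsLinColimit tr ι)

include h

lemma map_map {i j : J} (g : i ⟶ j) {m n : Type} (A : Matrix m n (M i)) :
    (A.map (tr g)).map (ι j) = A.map (ι i) := by
  ext a b
  exact h.ι_tr g _

/-- Linear maps from the colimit. -/
lemma exists_desc [IsFiltered J] {W : Type*} [AddCommGroup W] [Module 𝕜 W]
    (σ : ∀ j, M j →ₗ[𝕜] W) (hσ : ∀ ⦃i j : J⦄ (g : i ⟶ j) (x : M i), σ j (tr g x) = σ i x) :
    ∃ f : V →ₗ[𝕜] W, ∀ j x, f (ι j x) = σ j x := by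
  have key : ∀ {i j : J} (x : M i) (y : M j), ι i x = ι j y → σ i x = σ j y := by
    intro i j x y hxy
    obtain ⟨k, g, hk⟩ := h.exists_eq (tr (IsFiltered.leftToMax i j) x)
      (tr (IsFiltered.rightToMax i j) y) (by rw [h.ι_tr, h.ι_tr, hxy])
    have := congrArg (σ k) hk
    rwa [hσ, hσ, hσ, hσ] at this
  choose j x hx using h.exists_rep
  have hf : ∀ i (y : M i), σ (j (ι i y)) (x (ι i y)) = σ i y := fun i y => key _ _ (hx _)
  refine ⟨⟨⟨fun v => σ (j v) (x v), fun v v' => ?_⟩, fun c v => ?_⟩, fun i y => hf i y⟩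
  · have h1 : v + v' = ι _ (tr (IsFiltered.leftToMax (j v) (j v')) (x v) +
        tr (IsFiltered.rightToMax (j v) (j v')) (x v')) := by
      rw [map_add, h.ι_tr, h.ι_tr, hx, hx]
    refine (key _ _ ((hx _).trans h1)).trans ?_
    rw [map_add, hσ, hσ]
  · refine (key _ (c • x v) ((hx _).trans ?_)).trans (map_smul _ _ _)
    rw [map_smul, hx]

variable [IsCardinalFiltered J (Cardinal.aleph.{w} 1)]

lemma exists_rep_matrix {m n : Type} [Countable m] [Countable n] (A : Matrix m n V) :
    ∃ j, ∃ B : Matrix m n (M j), B.map (ι j) = A := by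
  choose j x hx using fun p : m × n => h.exists_rep (A p.1 p.2)
  have hK := hasCardinalLT_aleph_one_of_countable.{w} (m × n)
  refine ⟨IsCardinalFiltered.max j hK, Matrix.of fun a b =>
    tr (IsCardinalFiltered.toMax j hK (a, b)) (x (a, b)), ?_⟩
  ext a b
  exact (h.ι_tr _ _).trans (hx (a, b))

/-- Each equation holds along its own arrow out of j. Countably many arrows out of one object can be
completed to a cocone, and this is where ℵ₁-filteredness exceeds filteredness. -/
lemma exists_eq_of_countable {K : Type} [Countable K] {j : J} (x y : K → M j)
    (hxy : ∀ a, ι j (x a) = ι j (y a)) :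
    ∃ (k : J) (g : j ⟶ k), ∀ a, tr g (x a) = tr g (y a) := by
  choose k g hg using fun a => h.exists_eq (x a) (y a) (hxy a)
  obtain ⟨m, a, b, hab⟩ := IsCardinalFiltered.wideSpan g
    (hasCardinalLT_aleph_one_of_countable.{w} K)
  refine ⟨m, b, fun i => ?_⟩
  rw [← hab i, h.tr_comp, h.tr_comp, hg]

lemma exists_eq_matrix {m n : Type} [Countable m] [Countable n] {j : J} {A B : Matrix m n (M j)}
    (hAB : A.map (ι j) = B.map (ι j)) :
    ∃ (k : J) (g : j ⟶ k), A.map (tr g) = B.map (tr g) := by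
  obtain ⟨k, g, hg⟩ := h.exists_eq_of_countable (fun p : m × n => A p.1 p.2) (fun p => B p.1 p.2)
    fun p => congrFun (congrFun hAB p.1) p.2
  exact ⟨k, g, Matrix.ext fun a b => hg (a, b)⟩

/-- Countably many representatives of a matrix become equal at some stage. -/
lemma exists_common_matrix {m n : Type} [Countable m] [Countable n] {A : Matrix m n V}
    (j : ℕ → J) (B : ∀ a, Matrix m n (M (j a))) (hB : ∀ a, (B a).map (ι (j a)) = A) :
    ∃ (k : J) (g : ∀ a, j a ⟶ k) (C : Matrix m n (M k)), C.map (ι k) = A ∧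
      ∀ a, (B a).map (tr (g a)) = C := by
  have hK := hasCardinalLT_aleph_one_of_countable.{w} ℕ
  set l := IsCardinalFiltered.max j hK
  set t := IsCardinalFiltered.toMax j hK
  -- Once all representatives are moved to one stage, each is compared entrywise with the
  -- representative of index 0: countably many equations.
  obtain ⟨k, g, hg⟩ := h.exists_eq_of_countable
    (fun p : ℕ × m × n => tr (t p.1) (B p.1 p.2.1 p.2.2))
    (fun p => tr (t 0) (B 0 p.2.1 p.2.2)) (fun p => by
      rw [h.ι_tr, h.ι_tr]
      exact (congrFun (congrFun (hB p.1) p.2.1) p.2.2).trans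
        (congrFun (congrFun (hB 0) p.2.1) p.2.2).symm)
  refine ⟨k, fun a => t a ≫ g, (B 0).map (tr (t 0 ≫ g)), ?_, fun a => ?_⟩
  · rw [h.map_map, hB]
  · ext c d
    simp only [Matrix.map_apply]
    rw [h.tr_comp, h.tr_comp]
    exact hg (a, c, d)

end IsLinColimit

end LinColimit

/-! ### Countably directed colimits of operator spaces -/

-- Injectivity of g makes the 0-1 matrix X an isometry, so the submatrix is a contractive
-- compression.
open scoped Matrix.Norms.L2Operator in
lemma OperatorSpaceStructure.matNorm_submatrix_le {𝕜 : Type} [RCLike 𝕜] {V : Type w}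
    [AddCommGroup V] [Module 𝕜 V] (E : OperatorSpaceStructure 𝕜 V) {m n : ℕ}
    (A : Matrix (Fin n) (Fin n) V) {g : Fin m → Fin n} (hg : Function.Injective g) :
    E.matNorm m (A.submatrix g g) ≤ E.matNorm n A := by
  set X : Matrix (Fin n) (Fin m) 𝕜 := Matrix.of fun k i => if k = g i then 1 else 0 with hX
  have hX1 : ‖X‖ ≤ 1 := l2_opNorm_le_one_of_conjTranspose_mul_self (by
    ext a b
    simp [hX, Matrix.mul_apply, Matrix.one_apply, hg.eq_iff, eq_comm])
  have h1 : sandwich Xᴴ A X = A.submatrix g g := by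
    ext a b
    simp [hX, sandwich, apply_ite (starRingEnd 𝕜), ite_smul]
  have h2 := E.matNorm_sandwich_le Xᴴ A X
  rw [h1, Matrix.l2_opNorm_conjTranspose] at h2
  have h3 : 0 ≤ E.matNorm n A := apply_nonneg _ _
  refine h2.trans ?_
  calc _ ≤ 1 * E.matNorm n A * 1 := by gcongr
    _ = _ := by ring

namespace OSp

variable {𝕜 : Type} [RCLike 𝕜] {J : Type w} [SmallCategory J] {F : J ⥤ OSp.{w} 𝕜}

variable (F) in
/-- The transition maps of a diagram of operator spaces. -/
abbrev transition ⦃i j : J⦄ (g : i ⟶ j) : F.obj i →ₗ[𝕜] F.obj j := lin (F.map g)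

section Structure

variable {V : Type w} [AddCommGroup V] [Module 𝕜 V] {ι : ∀ j, F.obj j →ₗ[𝕜] V}

variable (ι) in
/-- The norm on the colimit: the infimum of the norms of the representatives. -/
def colimitNorm (n : ℕ) (A : Matrix (Fin n) (Fin n) V) : ℝ :=
  sInf {r | ∃ j, ∃ B : Matrix (Fin n) (Fin n) (F.obj j),
    B.map (ι j) = A ∧ (F.obj j).str.matNorm n B = r}

lemma colimitNorm_le {n : ℕ} {A : Matrix (Fin n) (Fin n) V} {j : J}
    {B : Matrix (Fin n) (Fin n) (F.obj j)} (hB : B.map (ι j) = A) :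
    colimitNorm ι n A ≤ (F.obj j).str.matNorm n B :=
  csInf_le ⟨0, by rintro _ ⟨j, B, _, rfl⟩; exact apply_nonneg _ _⟩ ⟨j, B, hB, rfl⟩

lemma colimitNorm_nonneg (n : ℕ) (A : Matrix (Fin n) (Fin n) V) : 0 ≤ colimitNorm ι n A :=
  Real.sInf_nonneg (by rintro _ ⟨j, B, _, rfl⟩; exact apply_nonneg _ _)

variable (h : IsLinColimit (transition F) ι) [IsCardinalFiltered J (Cardinal.aleph.{w} 1)]

include h

/-- The infimum is attained. Representatives of norm below the infimum plus 1/(a + 1) merge into one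
matrix at a later stage, and contractivity of the transition maps puts its norm below all of these
bounds. -/
lemma exists_colimitNorm {n : ℕ} (A : Matrix (Fin n) (Fin n) V) :
    ∃ j, ∃ B : Matrix (Fin n) (Fin n) (F.obj j),
      B.map (ι j) = A ∧ (F.obj j).str.matNorm n B ≤ colimitNorm ι n A := by
  have hne : {r | ∃ j, ∃ B : Matrix (Fin n) (Fin n) (F.obj j),
      B.map (ι j) = A ∧ (F.obj j).str.matNorm n B = r}.Nonempty := by
    obtain ⟨j, B, hB⟩ := h.exists_rep_matrix A
    exact ⟨_, j, B, hB, rfl⟩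
  have h1 : ∀ a : ℕ, ∃ j, ∃ B : Matrix (Fin n) (Fin n) (F.obj j), B.map (ι j) = A ∧
      (F.obj j).str.matNorm n B < colimitNorm ι n A + 1 / ((a : ℝ) + 1) := by
    intro a
    obtain ⟨_, ⟨j, B, hB, rfl⟩, hlt⟩ := exists_lt_of_csInf_lt hne
      (lt_add_of_pos_right (colimitNorm ι n A) (Nat.one_div_pos_of_nat (α := ℝ) (n := a)))
    exact ⟨j, B, hB, hlt⟩
  choose j B hB hlt using h1
  obtain ⟨k, g, C, hC, hBC⟩ := h.exists_common_matrix j B hB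
  refine ⟨k, C, hC, le_of_forall_pos_le_add fun ε hε => ?_⟩
  obtain ⟨a, ha⟩ := exists_nat_one_div_lt hε
  calc (F.obj k).str.matNorm n C ≤ (F.obj (j a)).str.matNorm n (B a) := by
        rw [← hBC a]; exact matNorm_map_le (F.map (g a)) (B a)
    _ ≤ _ := by linarith [hlt a]

lemma exists_colimitNorm₂ {m n : ℕ} (A : Matrix (Fin m) (Fin m) V)
    (A' : Matrix (Fin n) (Fin n) V) :
    ∃ j, ∃ (B : Matrix (Fin m) (Fin m) (F.obj j)) (B' : Matrix (Fin n) (Fin n) (F.obj j)),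
      B.map (ι j) = A ∧ B'.map (ι j) = A' ∧ (F.obj j).str.matNorm m B ≤ colimitNorm ι m A ∧
      (F.obj j).str.matNorm n B' ≤ colimitNorm ι n A' := by
  have := isFiltered_of_isCardinalFiltered J (Cardinal.aleph.{w} 1)
  obtain ⟨j, B, hB, hBA⟩ := exists_colimitNorm h A
  obtain ⟨j', B', hB', hBA'⟩ := exists_colimitNorm h A'
  exact ⟨_, B.map (transition F (IsFiltered.leftToMax j j')),
    B'.map (transition F (IsFiltered.rightToMax j j')), (h.map_map _ _).trans hB,
    (h.map_map _ _).trans hB', (matNorm_map_le (F.map _) B).trans hBA,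
    (matNorm_map_le (F.map _) B').trans hBA'⟩

open scoped Matrix.Norms.L2Operator in
/-- The operator space structure on a countably directed colimit. -/
def filteredColimitStructure : OperatorSpaceStructure 𝕜 V where
  matNorm n := Seminorm.ofSMulLE (colimitNorm ι n)
    (le_antisymm (by
      obtain ⟨j⟩ := IsCardinalFiltered.nonempty J (Cardinal.aleph.{w} 1)
      have := colimitNorm_le (ι := ι) (j := j) (B := 0) (A := (0 : Matrix (Fin n) (Fin n) V))
        (Matrix.map_zero _ (map_zero _))
      rwa [map_zero] at this) (colimitNorm_nonneg n 0))
    (fun A A' => by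
      obtain ⟨j, B, B', rfl, rfl, hB, hB'⟩ := exists_colimitNorm₂ h A A'
      refine (colimitNorm_le (B := B + B') (Matrix.map_add _ (map_add (ι j)) _ _)).trans ?_
      exact (map_add_le_add _ _ _).trans (add_le_add hB hB'))
    (fun c A => by
      obtain ⟨j, B, rfl, hB⟩ := exists_colimitNorm h A
      refine (colimitNorm_le (B := c • B) (Matrix.map_smul _ c (map_smul (ι j) c) _)).trans ?_
      rw [map_smul_eq_mul]
      exact mul_le_mul_of_nonneg_left hB (norm_nonneg _))
  eq_zero_of_matNorm {n} A hA := by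
    -- Definiteness rests on attainment: some representative has norm zero at its own stage.
    obtain ⟨j, B, rfl, hB⟩ := exists_colimitNorm h A
    have hB0 : B = 0 := (F.obj j).str.eq_zero_of_matNorm B
      (le_antisymm (hB.trans (le_of_eq hA)) (apply_nonneg _ _))
    rw [hB0]
    exact Matrix.map_zero _ (map_zero _)
  matNorm_sandwich_le {m n} X A Y := by
    obtain ⟨j, B, rfl, hB⟩ := exists_colimitNorm h A
    refine (colimitNorm_le (map_sandwich (ι j) X B Y)).trans ?_
    refine ((F.obj j).str.matNorm_sandwich_le X B Y).trans ?_
    change _ ≤ ‖X‖ * colimitNorm ι n _ * ‖Y‖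
    gcongr
  matNorm_directSum {m n} A A' := by
    change colimitNorm ι _ _ = max (colimitNorm ι _ _) (colimitNorm ι _ _)
    refine le_antisymm ?_ (max_le ?_ ?_)
    · obtain ⟨j, B, B', rfl, rfl, hB, hB'⟩ := exists_colimitNorm₂ h A A'
      refine (colimitNorm_le (B := block B 0 0 B') ?_).trans ?_
      · rw [map_block]
        simp
      · rw [(F.obj j).str.matNorm_directSum]
        exact max_le_max hB hB'
    -- An optimal representative C need not be block diagonal, but its corner represents A with no
    -- larger norm.
    · obtain ⟨j, C, hC, hle⟩ := exists_colimitNorm h (block A 0 0 A')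
      refine (colimitNorm_le (B := C.submatrix (Fin.castAdd n) (Fin.castAdd n)) ?_).trans
        (((F.obj j).str.matNorm_submatrix_le C (Fin.castAdd_injective m n)).trans hle)
      rw [← Matrix.submatrix_map, hC]
      ext a b
      simp [block]
    · obtain ⟨j, C, hC, hle⟩ := exists_colimitNorm h (block A 0 0 A')
      refine (colimitNorm_le (B := C.submatrix (Fin.natAdd m) (Fin.natAdd m)) ?_).trans
        (((F.obj j).str.matNorm_submatrix_le C (Fin.natAdd_injective n m)).trans hle)
      rw [← Matrix.submatrix_map, hC]
      ext a b
      simp [block]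

/-- The cocone given by the structure on a countably directed colimit. -/
def filteredCocone : Cocone F where
  pt := { carrier := V, str := filteredColimitStructure h }
  ι :=
    { app j := Hom.mk (ι j) fun _ _ => colimitNorm_le rfl
      naturality _ _ g := hom_ext fun x => h.ι_tr g x }

end Structure

/-- A cocone whose underlying cocone of sets is a filtered colimit, such that matrices have
representatives of the same norm, is a colimit of operator spaces. -/
lemma isColimit_of_isLinColimit [IsFiltered J] (c : Cocone F)
    (h : IsLinColimit (transition F) (fun j => lin (c.ι.app j)))
    (hc : ∀ (n : ℕ) (A : Matrix (Fin n) (Fin n) c.pt), ∃ j,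
      ∃ B : Matrix (Fin n) (Fin n) (F.obj j), B.map (lin (c.ι.app j)) = A ∧
        (F.obj j).str.matNorm n B ≤ c.pt.str.matNorm n A) : Nonempty (IsColimit c) := by
  choose f hf using fun s : Cocone F => h.exists_desc (fun j => lin (s.ι.app j))
    (fun i j g x => lin_cocone_w F s g x)
  refine ⟨⟨fun s => Hom.mk (f s) fun n A => ?_, fun s j => hom_ext fun x => hf s j x,
    fun s m hm => hom_ext fun v => ?_⟩⟩
  · obtain ⟨j, B, rfl, hB⟩ := hc n A
    refine le_trans (le_of_eq_of_le (congrArg _ ?_) (matNorm_map_le (s.ι.app j) B)) hB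
    ext a b
    exact hf s j _
  · obtain ⟨j, x, rfl⟩ := h.exists_rep v
    exact (congrArg (fun k : F.obj j ⟶ s.pt => lin k x) (hm j)).trans (hf s j x).symm

lemma isColimit_forget_of_isLinColimit [IsFiltered J] (c : Cocone F)
    (h : IsLinColimit (transition F) (fun j => lin (c.ι.app j))) :
    Nonempty (IsColimit ((forget (OSp.{w} 𝕜)).mapCocone c)) :=
  ⟨Types.FilteredColimit.isColimitOf' _ _
    (fun v => by
      obtain ⟨j, x, hx⟩ := h.exists_rep v
      exact ⟨j, x, hx.symm⟩)
    (fun _ x y hxy => h.exists_eq x y hxy)⟩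

variable (𝕜) in
/-- The forgetful functor to vector spaces. -/
def toModuleCat : OSp.{w} 𝕜 ⥤ ModuleCat.{w} 𝕜 where
  obj X := ModuleCat.of 𝕜 X
  map f := ModuleCat.ofHom (lin f)

variable (F) in
lemma exists_isLinColimit [IsFiltered J] :
    ∃ (V : Type w) (_ : AddCommGroup V) (_ : Module 𝕜 V) (ι : ∀ j, F.obj j →ₗ[𝕜] V),
      IsLinColimit (transition F) ι :=
  IsLinColimit.exists_of_isFiltered (F ⋙ toModuleCat 𝕜)

variable (F) in
/-- Countably directed colimits of operator spaces are computed on underlying sets, and matrices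
have representatives of the same norm. -/
lemma exists_isColimit [IsCardinalFiltered J (Cardinal.aleph.{w} 1)] :
    ∃ c : Cocone F, Nonempty (IsColimit c) ∧
      IsLinColimit (transition F) (fun j => lin (c.ι.app j)) ∧
      ∀ (n : ℕ) (A : Matrix (Fin n) (Fin n) c.pt), ∃ j,
        ∃ B : Matrix (Fin n) (Fin n) (F.obj j), B.map (lin (c.ι.app j)) = A ∧
          (F.obj j).str.matNorm n B ≤ c.pt.str.matNorm n A := by
  have := isFiltered_of_isCardinalFiltered J (Cardinal.aleph.{w} 1)
  obtain ⟨V, _, _, ι, h⟩ := exists_isLinColimit F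
  have h2 : ∀ (n : ℕ) (A : Matrix (Fin n) (Fin n) (filteredCocone h).pt), ∃ j,
        ∃ B : Matrix (Fin n) (Fin n) (F.obj j), B.map (lin ((filteredCocone h).ι.app j)) = A ∧
          (F.obj j).str.matNorm n B ≤ (filteredCocone h).pt.str.matNorm n A :=
    fun n A => exists_colimitNorm h A
  exact ⟨filteredCocone h, isColimit_of_isLinColimit _ h h2, h, h2⟩

instance : (forget (OSp.{w} 𝕜)).IsCardinalAccessible (Cardinal.aleph.{w} 1) where
  preservesColimitOfShape J _ _ :=
    ⟨fun {F} => by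
      have := isFiltered_of_isCardinalFiltered J (Cardinal.aleph.{w} 1)
      obtain ⟨c, ⟨hc⟩, h, -⟩ := exists_isColimit F
      exact preservesColimit_of_preserves_colimit_cocone hc
        (isColimit_forget_of_isLinColimit c h).some⟩

/-! ### The unit ball objects form a strong generator -/

/-- Morphisms out of the ball object are matrices of norm at most one. Such a matrix over the
colimit lifts without increase of norm, hence into the closed unit ball at some stage, and two lifts
agree later. -/
instance isCardinalPresentable_ballObj (n : ℕ) :
    IsCardinalPresentable (ballObj.{w} 𝕜 n) (Cardinal.aleph.{w} 1) where
  preservesColimitOfShape J _ _ :=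
    ⟨fun {F} => by
      have := isFiltered_of_isCardinalFiltered J (Cardinal.aleph.{w} 1)
      obtain ⟨c, ⟨hc⟩, h, hn⟩ := exists_isColimit F
      refine preservesColimit_of_preserves_colimit_cocone hc
        (Types.FilteredColimit.isColimitOf' _ _ (fun f => ?_) fun j f g hfg => ?_)
      · obtain ⟨j, B, hB, hle⟩ := hn n ((ballMat.{w} 𝕜 n).map (lin f))
        refine ⟨j, ballDesc B (hle.trans ((matNorm_map_le f _).trans matNorm_ballMat_le)), ?_⟩
        refine ballObj_hom_ext (hB.symm.trans ?_)
        exact congrArg (fun A => A.map (lin (c.ι.app j))) (ballMat_map_ballDesc B _).symm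
      · obtain ⟨k, g', hg⟩ := h.exists_eq_matrix (A := (ballMat.{w} 𝕜 n).map (lin f))
          (B := (ballMat.{w} 𝕜 n).map (lin g))
          (congrArg (fun f' : ballObj.{w} 𝕜 n ⟶ c.pt => (ballMat.{w} 𝕜 n).map (lin f')) hfg)
        exact ⟨k, g', ballObj_hom_ext hg⟩⟩

variable (𝕜) in
/-- The unit ball objects. -/
def ballObjects : ObjectProperty (OSp.{w} 𝕜) := ObjectProperty.ofObj (ballObj.{w} 𝕜)

instance : ObjectProperty.Small.{w} (ballObjects.{w} 𝕜) :=
  inferInstanceAs (ObjectProperty.Small.{w} (ObjectProperty.ofObj (ballObj.{w} 𝕜)))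

lemma matNorm_inv_smul_le {Z : OSp.{w} 𝕜} {n : ℕ} {A : Matrix (Fin n) (Fin n) Z} {r : ℝ}
    (hr : 0 < r) (hA : Z.str.matNorm n A ≤ r) :
    Z.str.matNorm n (((r⁻¹ : ℝ) : 𝕜) • A) ≤ 1 := by
  rw [map_smul_eq_mul, RCLike.norm_ofReal, abs_of_pos (inv_pos.mpr hr), inv_mul_le_iff₀ hr,
    mul_one]
  exact hA

lemma isIso_of_bijective {X Y : OSp.{w} 𝕜} (f : X ⟶ Y) (hf : Function.Bijective (lin f))
    (h : ∀ (n : ℕ) (A : Matrix (Fin n) (Fin n) X),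
      X.str.matNorm n A ≤ Y.str.matNorm n (A.map (lin f))) : IsIso f := by
  let e : X ≃ₗ[𝕜] Y := LinearEquiv.ofBijective (lin f) hf
  refine ⟨Hom.mk e.symm.toLinearMap fun n A => ?_, hom_ext fun x => e.symm_apply_apply x,
    hom_ext fun y => e.apply_symm_apply y⟩
  refine (h n _).trans (le_of_eq (congrArg _ ?_))
  ext a b
  exact e.apply_symm_apply _

/-- Up to a nonzero scalar every vector is hit by a morphism from the 1 × 1 ball, which gives
separation and bijectivity; lifting matrices of the unit ball of Mₙ makes the inverse completely
contractive. -/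
lemma isStrongGenerator_ballObjects : (ballObjects.{w} 𝕜).IsStrongGenerator := by
  rw [ObjectProperty.isStrongGenerator_iff]
  have hG : ∀ n, ballObjects.{w} 𝕜 (ballObj.{w} 𝕜 n) := ObjectProperty.ofObj_apply _
  have key : ∀ {X : OSp.{w} 𝕜} (x : X), ∃ (c : 𝕜) (_ : c ≠ 0) (f : ballObj.{w} 𝕜 1 ⟶ X),
      lin f (ballMat.{w} 𝕜 1 0 0) = c • x := by
    intro X x
    have hr : 0 < X.str.norm₁ x + 1 := by linarith [X.str.norm₁_nonneg x]
    refine ⟨(((X.str.norm₁ x + 1)⁻¹ : ℝ) : 𝕜), by exact_mod_cast (inv_pos.mpr hr).ne',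
      ballDesc _ (matNorm_inv_smul_le (A := Matrix.of fun (_ _ : Fin 1) => x) hr
        (le_add_of_nonneg_right zero_le_one)), ?_⟩
    exact congrFun (congrFun (ballMat_map_ballDesc _ _) 0) 0
  have key₂ : ∀ {X Y : OSp.{w} 𝕜} {f g : X ⟶ Y}, (∀ h : ballObj.{w} 𝕜 1 ⟶ X, h ≫ f = h ≫ g) →
      f = g := by
    intro X Y f g h
    refine hom_ext fun x => ?_
    obtain ⟨c, hc, k, hk⟩ := key x
    have h1 : lin f (lin k (ballMat.{w} 𝕜 1 0 0)) = lin g (lin k (ballMat.{w} 𝕜 1 0 0)) :=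
      congrArg (fun k : ballObj.{w} 𝕜 1 ⟶ Y => lin k (ballMat.{w} 𝕜 1 0 0)) (h k)
    rw [hk, map_smul, map_smul] at h1
    exact smul_right_injective _ hc h1
  refine ⟨fun X Y f g h => key₂ fun k => h _ (hG 1) k, fun X Y i _ h => ?_⟩
  have hinj : Function.Injective (lin i) := by
    rw [← LinearMap.ker_eq_bot, LinearMap.ker_eq_bot']
    intro x hx
    obtain ⟨c, hc, k, hk⟩ := key x
    have h0 : X.str.matNorm 1 0 ≤ 1 := by rw [map_zero]; exact zero_le_one
    -- If i x = 0, then k and the zero morphism agree after the monomorphism i.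
    have h1 : k = ballDesc 0 h0 := by
      rw [← cancel_mono i]
      refine ballObj_hom_ext ?_
      ext a b
      have ha : ballMat.{w} 𝕜 1 a b = ballMat.{w} 𝕜 1 0 0 := by
        rw [Subsingleton.elim a 0, Subsingleton.elim b 0]
      have h2 : lin (ballDesc 0 h0) (ballMat.{w} 𝕜 1 a b) = 0 :=
        congrFun (congrFun (ballMat_map_ballDesc 0 h0) a) b
      change lin i (lin k (ballMat.{w} 𝕜 1 a b)) = lin i (lin (ballDesc 0 h0) _)
      rw [h2, ha, hk, map_smul, hx, smul_zero, map_zero]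
    have h2 : lin k (ballMat.{w} 𝕜 1 0 0) = 0 := by
      rw [h1]
      exact congrFun (congrFun (ballMat_map_ballDesc 0 h0) 0) 0
    rw [hk] at h2
    exact (smul_eq_zero.mp h2).resolve_left hc
  refine isIso_of_bijective i ⟨hinj, fun y => ?_⟩ fun n A => ?_
  · obtain ⟨c, hc, k, hk⟩ := key y
    obtain ⟨k', hk'⟩ := h _ (hG 1) k
    refine ⟨c⁻¹ • lin k' (ballMat.{w} 𝕜 1 0 0), ?_⟩
    have h1 : lin i (lin k' (ballMat.{w} 𝕜 1 0 0)) = lin k (ballMat.{w} 𝕜 1 0 0) :=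
      congrArg (fun k : ballObj.{w} 𝕜 1 ⟶ Y => lin k (ballMat.{w} 𝕜 1 0 0)) hk'
    rw [map_smul, h1, hk, inv_smul_smul₀ hc]
  -- The margin ε makes r positive, so that the image of A can be scaled into the unit ball even
  -- when its norm is zero.
  · refine le_of_forall_pos_le_add fun ε hε => ?_
    set r : ℝ := Y.str.matNorm n (A.map (lin i)) + ε with hr
    have hr0 : 0 < r := add_pos_of_nonneg_of_pos (apply_nonneg _ _) hε
    have hrc : ((r⁻¹ : ℝ) : 𝕜) ≠ 0 := by exact_mod_cast (inv_pos.mpr hr0).ne'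
    obtain ⟨k, hk⟩ := h _ (hG n) (ballDesc _ (matNorm_inv_smul_le (A := A.map (lin i)) hr0
      (le_add_of_nonneg_right hε.le)))
    -- By injectivity the lifted matrix can only be r⁻¹ A, and it lies in the unit ball.
    have h1 : (ballMat.{w} 𝕜 n).map (lin k) = ((r⁻¹ : ℝ) : 𝕜) • A := by
      ext a b
      apply hinj
      have h2 := congrFun (congrFun ((congrArg (fun k : ballObj.{w} 𝕜 n ⟶ Y =>
        (ballMat.{w} 𝕜 n).map (lin k)) hk).trans (ballMat_map_ballDesc _ _)) a) b
      refine h2.trans ?_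
      simp
    have h2 := (matNorm_map_le k _).trans (matNorm_ballMat_le (𝕜 := 𝕜) (n := n))
    rw [h1, map_smul_eq_mul, RCLike.norm_ofReal, abs_of_pos (inv_pos.mpr hr0),
      inv_mul_le_iff₀ hr0, mul_one] at h2
    exact h2

instance : IsCardinalLocallyPresentable (OSp.{w} 𝕜) (Cardinal.aleph.{w} 1) := by
  rw [IsCardinalLocallyPresentable.iff_exists_isStrongGenerator]
  refine ⟨ballObjects.{w} 𝕜, inferInstance, isStrongGenerator_ballObjects, ?_⟩
  rintro _ ⟨n⟩
  exact isCardinalPresentable_ballObj n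

end OSp

/-! ### Countably directed colimits of operator systems -/

namespace OSys

variable {𝕜 : Type} [RCLike 𝕜] {J : Type w} [SmallCategory J] {F : J ⥤ OSys.{w} 𝕜}

variable (F) in
/-- The transition maps of a diagram of operator systems. -/
abbrev transition ⦃i j : J⦄ (g : i ⟶ j) : F.obj i →ₗ[𝕜] F.obj j := lin (F.map g)

section Structure

variable {V : Type w} [AddCommGroup V] [Module 𝕜 V] {ι : ∀ j, F.obj j →ₗ[𝕜] V}
  (h : IsLinColimit (transition F) ι)

include h

lemma exists_colimit_star [IsFiltered J] :
    ∃ s : V → V, ∀ j (x : F.obj j), s (ι j x) = ι j (star x) := by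
  choose j x hx using h.exists_rep
  refine ⟨fun v => ι (j v) (star (x v)), fun i y => ?_⟩
  obtain ⟨k, g, hk⟩ := h.exists_eq (transition F (IsFiltered.leftToMax (j (ι i y)) i) (x (ι i y)))
    (transition F (IsFiltered.rightToMax (j (ι i y)) i) y) (by rw [h.ι_tr, h.ι_tr, hx])
  have h1 := congrArg (fun z => ι k (star z)) hk
  simp only [transition, ← lin_star] at h1
  rwa [h.ι_tr, h.ι_tr, h.ι_tr, h.ι_tr] at h1

lemma exists_colimit_unit [IsFiltered J] : ∃ e : V, ∀ j, ι j (F.obj j).str.unit = e := by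
  obtain ⟨j₀⟩ := IsFiltered.nonempty (C := J)
  refine ⟨ι j₀ (F.obj j₀).str.unit, fun j => ?_⟩
  rw [← h.ι_tr (IsFiltered.leftToMax j j₀), ← h.ι_tr (IsFiltered.rightToMax j j₀)]
  exact congrArg _ ((lin_unit _).trans (lin_unit _).symm)

/-- The involution on a filtered colimit. -/
@[reducible]
def colimitStar [IsFiltered J] : StarAddMonoid V where
  star := (exists_colimit_star h).choose
  star_involutive v := by
    obtain ⟨j, x, rfl⟩ := h.exists_rep v
    have hs := (exists_colimit_star h).choose_spec
    exact (congrArg _ (hs j x)).trans ((hs j _).trans (by rw [star_star]))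
  star_add v v' := by
    obtain ⟨j, x, rfl⟩ := h.exists_rep v
    obtain ⟨j', x', rfl⟩ := h.exists_rep v'
    have hs := (exists_colimit_star h).choose_spec
    rw [← h.ι_tr (IsFiltered.leftToMax j j'), ← h.ι_tr (IsFiltered.rightToMax j j'), ← map_add]
    refine (hs _ _).trans ?_
    rw [star_add, map_add]
    exact congrArg₂ _ (hs _ _).symm (hs _ _).symm

lemma ι_colimitStar [IsFiltered J] (j : J) (x : F.obj j) :
    ι j (star x) = (colimitStar h).star (ι j x) :=
  ((exists_colimit_star h).choose_spec j x).symm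

lemma colimitStarModule [IsFiltered J] : @StarModule 𝕜 V _ (colimitStar h).toStar _ :=
  let := colimitStar h
  ⟨fun c v => by
    obtain ⟨j, x, rfl⟩ := h.exists_rep v
    rw [← map_smul]
    refine (ι_colimitStar h j _).symm.trans ?_
    rw [star_smul, map_smul]
    exact congrArg _ (ι_colimitStar h j x)⟩

variable [IsCardinalFiltered J (Cardinal.aleph.{w} 1)]

section

variable [StarAddMonoid V] [StarModule 𝕜 V] (hstar : ∀ j (x : F.obj j), ι j (star x) = star (ι j x))
  {e : V} (he : ∀ j, ι j (F.obj j).str.unit = e)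

omit h [IsCardinalFiltered J (Cardinal.aleph.{w} 1)] [StarAddMonoid V] [StarModule 𝕜 V] in
include he in
lemma map_diagonal_colimit_unit (j : J) (c : 𝕜) (n : ℕ) :
    (c • Matrix.diagonal (fun _ : Fin n => (F.obj j).str.unit)).map (ι j) =
      c • Matrix.diagonal (fun _ => e) := by
  ext a b
  by_cases hab : a = b <;> simp [hab, he]

/-- The operator system structure on a countably directed colimit. -/
def filteredColimitStructure : OperatorSystemStructure 𝕜 V where
  cone n := {A | ∃ j, ∃ B ∈ (F.obj j).str.cone n, B.map (ι j) = A}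
  unit := e
  isHermitian_of_mem := by
    rintro n _ ⟨j, B, hB, rfl⟩
    ext a b
    have := congrArg (ι j) (((F.obj j).str.isHermitian_of_mem hB).apply a b)
    rwa [hstar] at this
  zero_mem n := by
    obtain ⟨j⟩ := IsCardinalFiltered.nonempty J (Cardinal.aleph.{w} 1)
    exact ⟨j, 0, (F.obj j).str.zero_mem n, Matrix.map_zero _ (map_zero _)⟩
  add_mem := by
    have := isFiltered_of_isCardinalFiltered J (Cardinal.aleph.{w} 1)
    rintro n _ _ ⟨j, B, hB, rfl⟩ ⟨j', B', hB', rfl⟩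
    refine ⟨_, _, (F.obj _).str.add_mem (map_mem_cone (F.map (IsFiltered.leftToMax j j')) hB)
      (map_mem_cone (F.map (IsFiltered.rightToMax j j')) hB'), ?_⟩
    rw [Matrix.map_add _ (map_add _)]
    exact congrArg₂ _ (h.map_map _ B) (h.map_map _ B')
  conj_mem := by
    rintro m n _ X ⟨j, B, hB, rfl⟩
    exact ⟨j, _, (F.obj j).str.conj_mem X hB, map_sandwich _ _ _ _⟩
  eq_zero_of_mem := by
    have := isFiltered_of_isCardinalFiltered J (Cardinal.aleph.{w} 1)
    rintro n _ ⟨j, B, hB, rfl⟩ ⟨j', B', hB', hBB'⟩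
    have h1 := map_mem_cone (F.map (IsFiltered.leftToMax j j')) hB
    have h2 := map_mem_cone (F.map (IsFiltered.rightToMax j j')) hB'
    -- The representatives of A and of -A become opposite at some stage, where properness of the
    -- cone applies.
    obtain ⟨k, g, hk⟩ := h.exists_eq_matrix
      (A := -(B.map (transition F (IsFiltered.leftToMax j j'))))
      (B := B'.map (transition F (IsFiltered.rightToMax j j'))) (by
        rw [h.map_map, hBB', ← h.map_map (IsFiltered.leftToMax j j') B]
        ext a b
        simp)
    have h3 := map_mem_cone (F.map g) h1
    have h4 := map_mem_cone (F.map g) h2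
    rw [← hk] at h4
    have h5 := (F.obj k).str.eq_zero_of_mem h3 (by
      convert h4 using 1
      ext a b
      simp)
    rw [← h.map_map (IsFiltered.leftToMax j j') B, ← h.map_map g, h5]
    exact Matrix.map_zero _ (map_zero _)
  star_unit := by
    obtain ⟨j⟩ := IsCardinalFiltered.nonempty J (Cardinal.aleph.{w} 1)
    rw [← he j, ← hstar, (F.obj j).str.star_unit]
  order_unit {n} A hA := by
    obtain ⟨j, B, rfl⟩ := h.exists_rep_matrix A
    -- A representative of a Hermitian matrix becomes Hermitian at a later stage.
    obtain ⟨k, g, hk⟩ := h.exists_eq_matrix (A := Bᴴ) (B := B) (by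
      refine Eq.trans ?_ hA
      ext a b
      exact hstar _ _)
    obtain ⟨r, hr, hB⟩ := (F.obj k).str.order_unit (B.map (transition F g))
      ((map_conjTranspose (F.map g) B).symm.trans hk)
    refine ⟨r, hr, k, _, hB, ?_⟩
    rw [← h.map_map g, ← map_diagonal_colimit_unit he k]
    ext a b
    simp
  archimedean {n} A hA hr := by
    have hr' : ∀ a : ℕ, ∃ j, ∃ P ∈ (F.obj j).str.cone n, P.map (ι j) =
        ((1 / ((a : ℝ) + 1) : ℝ) : 𝕜) • Matrix.diagonal (fun _ => e) + A :=
      fun a => hr _ Nat.one_div_pos_of_nat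
    choose j P hP hPA using hr'
    -- Subtracting e/(a + 1) from a positive representative of e/(a + 1) + A gives, for each a, a
    -- representative of A. They merge into one C with e/(a + 1) + C positive for all a, and the
    -- Archimedean property is used at that stage.
    obtain ⟨k, g, C, hC, hPC⟩ := h.exists_common_matrix (A := A) j
      (fun a => P a - ((1 / ((a : ℝ) + 1) : ℝ) : 𝕜) •
        Matrix.diagonal (fun _ => (F.obj (j a)).str.unit)) (fun a => by
        rw [Matrix.map_sub _ (map_sub _), hPA, map_diagonal_colimit_unit he]
        abel)
    have hmem : ∀ a : ℕ, ((1 / ((a : ℝ) + 1) : ℝ) : 𝕜) •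
        Matrix.diagonal (fun _ => (F.obj k).str.unit) + C ∈ (F.obj k).str.cone n := by
      intro a
      have h1 := map_mem_cone (F.map (g a)) (hP a)
      convert h1 using 1
      rw [← hPC a, Matrix.map_sub _ (map_sub _), map_diagonal_unit (lin_unit (F.map (g a)))]
      abel
    refine ⟨k, C, (F.obj k).str.archimedean C ?_ fun r hr0 => ?_, hC⟩
    -- C is the difference of the Hermitian matrices e + C and e, the case a = 0.
    · have h1 := ((F.obj k).str.isHermitian_of_mem (hmem 0)).sub
        ((F.obj k).str.isHermitian_unit (n := Fin n) (1 / (((0 : ℕ) : ℝ) + 1)))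
      rwa [add_sub_cancel_left] at h1
    · obtain ⟨a, ha⟩ := exists_nat_one_div_lt hr0
      have h1 := (F.obj k).str.add_mem ((F.obj k).str.unit_mem (n := n) (sub_nonneg.mpr ha.le))
        (hmem a)
      convert h1 using 1
      rw [← add_assoc, ← add_smul, ← RCLike.ofReal_add, sub_add_cancel]

end

/-- The cocone given by the structure on a countably directed colimit. -/
lemma exists_cocone : ∃ c : Cocone F,
    IsLinColimit (transition F) (fun j => lin (c.ι.app j)) ∧
    ∀ (n : ℕ) (A : Matrix (Fin n) (Fin n) c.pt), A ∈ c.pt.str.cone n →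
      ∃ j, ∃ B ∈ (F.obj j).str.cone n, B.map (lin (c.ι.app j)) = A := by
  have := isFiltered_of_isCardinalFiltered J (Cardinal.aleph.{w} 1)
  let := colimitStar h
  have := colimitStarModule h
  obtain ⟨e, he⟩ := exists_colimit_unit h
  exact ⟨{
    pt := { carrier := V, str := filteredColimitStructure h (ι_colimitStar h) he }
    ι :=
      { app j := Hom.mk (ι j) (he j) fun n A hA => ⟨j, A, hA, rfl⟩
        naturality _ _ g := hom_ext fun x => h.ι_tr g x } }, h, fun n A hA => hA⟩

end Structure

/-- A cocone whose underlying cocone of sets is a filtered colimit, such that positive matrices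
have positive representatives, is a colimit of operator systems. -/
lemma isColimit_of_isLinColimit [IsFiltered J] (c : Cocone F)
    (h : IsLinColimit (transition F) (fun j => lin (c.ι.app j)))
    (hc : ∀ (n : ℕ) (A : Matrix (Fin n) (Fin n) c.pt), A ∈ c.pt.str.cone n →
      ∃ j, ∃ B ∈ (F.obj j).str.cone n, B.map (lin (c.ι.app j)) = A) :
    Nonempty (IsColimit c) := by
  choose f hf using fun s : Cocone F => h.exists_desc (fun j => lin (s.ι.app j))
    (fun i j g x => lin_cocone_w F s g x)
  refine ⟨⟨fun s => Hom.mk (f s) ?_ fun n A hA => ?_, fun s j => hom_ext fun x => hf s j x,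
    fun s m hm => hom_ext fun v => ?_⟩⟩
  · obtain ⟨j⟩ := IsFiltered.nonempty (C := J)
    have h1 := hf s j (F.obj j).str.unit
    rw [lin_unit, lin_unit] at h1
    exact h1
  · obtain ⟨j, B, hB, rfl⟩ := hc n A hA
    refine (congrArg (· ∈ s.pt.str.cone n) (Matrix.ext fun a b => hf s j _)).mpr
      (map_mem_cone (s.ι.app j) hB)
  · obtain ⟨j, x, rfl⟩ := h.exists_rep v
    exact (congrArg (fun k : F.obj j ⟶ s.pt => lin k x) (hm j)).trans (hf s j x).symm

lemma isColimit_forget_of_isLinColimit [IsFiltered J] (c : Cocone F)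
    (h : IsLinColimit (transition F) (fun j => lin (c.ι.app j))) :
    Nonempty (IsColimit ((forget (OSys.{w} 𝕜)).mapCocone c)) :=
  ⟨Types.FilteredColimit.isColimitOf' _ _
    (fun v => by
      obtain ⟨j, x, hx⟩ := h.exists_rep v
      exact ⟨j, x, hx.symm⟩)
    (fun _ x y hxy => h.exists_eq x y hxy)⟩

/-- With r the norm of A, the positive block matrix expressing ‖A‖ ≤ r lifts to a positive matrix.
At a later stage that lift acquires the block form of a representative of A, which therefore has
norm at most r. -/
lemma isColimit_forgetToOSp_of_isLinColimit [IsCardinalFiltered J (Cardinal.aleph.{w} 1)]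
    (c : Cocone F) (h : IsLinColimit (transition F) (fun j => lin (c.ι.app j)))
    (hc : ∀ (n : ℕ) (A : Matrix (Fin n) (Fin n) c.pt), A ∈ c.pt.str.cone n →
      ∃ j, ∃ B ∈ (F.obj j).str.cone n, B.map (lin (c.ι.app j)) = A) :
    Nonempty (IsColimit ((forgetToOSp 𝕜).mapCocone c)) := by
  have := isFiltered_of_isCardinalFiltered J (Cardinal.aleph.{w} 1)
  have key : ∀ (n : ℕ) (A : Matrix (Fin n) (Fin n) c.pt), ∃ j,
      ∃ B : Matrix (Fin n) (Fin n) (F.obj j), B.map (lin (c.ι.app j)) = A ∧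
        (F.obj j).str.normFun n B ≤ c.pt.str.normFun n A := by
    intro n A
    obtain ⟨i, P, hP, hPA⟩ := hc _ _ ((c.pt.str.normFun_le_iff (c.pt.str.normFun_nonneg n A) A).mp
      le_rfl)
    obtain ⟨j, B, rfl⟩ := h.exists_rep_matrix A
    set r := c.pt.str.normFun n (B.map (lin (c.ι.app j)))
    obtain ⟨k, g, hk⟩ := h.exists_eq_matrix
      (A := P.map (transition F (IsFiltered.leftToMax i j)))
      (B := (F.obj _).str.normBlock r (B.map (transition F (IsFiltered.rightToMax i j)))) (by
        rw [h.map_map, hPA, map_normBlock (c.ι.app _), h.map_map]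
        rfl)
    have h1 := map_mem_cone (F.map g) (map_mem_cone (F.map (IsFiltered.leftToMax i j)) hP)
    refine ⟨k, (B.map (transition F (IsFiltered.rightToMax i j))).map (transition F g),
      by rw [h.map_map, h.map_map], ?_⟩
    rw [OperatorSystemStructure.normFun_le_iff _ (c.pt.str.normFun_nonneg n _)]
    rw [hk, map_normBlock] at h1
    exact h1
  exact OSp.isColimit_of_isLinColimit (F := F ⋙ forgetToOSp 𝕜) _ h key

variable (F) in
/-- Countably directed colimits of operator systems are computed on underlying sets. -/
lemma exists_isColimit [IsCardinalFiltered J (Cardinal.aleph.{w} 1)] :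
    ∃ c : Cocone F, Nonempty (IsColimit c) ∧
      Nonempty (IsColimit ((forget (OSys.{w} 𝕜)).mapCocone c)) ∧
      Nonempty (IsColimit ((forgetToOSp 𝕜).mapCocone c)) := by
  have := isFiltered_of_isCardinalFiltered J (Cardinal.aleph.{w} 1)
  obtain ⟨V, _, _, ι, h⟩ := OSp.exists_isLinColimit (F ⋙ forgetToOSp 𝕜)
  obtain ⟨c, h1, h2⟩ := exists_cocone (F := F) (ι := ι) h
  exact ⟨c, isColimit_of_isLinColimit c h1 h2, isColimit_forget_of_isLinColimit c h1,
    isColimit_forgetToOSp_of_isLinColimit c h1 h2⟩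

instance : (forget (OSys.{w} 𝕜)).IsCardinalAccessible (Cardinal.aleph.{w} 1) where
  preservesColimitOfShape J _ _ :=
    ⟨fun {F} => by
      obtain ⟨c, ⟨hc⟩, ⟨h⟩, -⟩ := exists_isColimit F
      exact preservesColimit_of_preserves_colimit_cocone hc h⟩

instance : (forgetToOSp.{w} 𝕜).IsCardinalAccessible (Cardinal.aleph.{w} 1) where
  preservesColimitOfShape J _ _ :=
    ⟨fun {F} => by
      obtain ⟨c, ⟨hc⟩, -, ⟨h⟩⟩ := exists_isColimit F
      exact preservesColimit_of_preserves_colimit_cocone hc h⟩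

end OSys

/-! ### Transfer of local presentability along the adjunction. -/

/-- The left adjoint of a faithful functor reflecting isomorphisms maps strong generators to
strong generators. -/
lemma isStrongGenerator_strictMap {C D : Type*} [Category* C] [Category* D] {L : C ⥤ D}
    {R : D ⥤ C} (adj : L ⊣ R) [R.Faithful] [R.ReflectsIsomorphisms] {P : ObjectProperty C}
    (hP : P.IsStrongGenerator) : (P.strictMap L).IsStrongGenerator := by
  rw [ObjectProperty.isStrongGenerator_iff]
  have := adj.isRightAdjoint
  refine ⟨fun X Y f g h => R.map_injective (hP.isSeparating _ _ fun G hG k => ?_),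
    fun X Y i _ h => ?_⟩
  · have h1 := congrArg (adj.homEquiv _ _)
      (h _ (P.strictMap_obj L hG) ((adj.homEquiv _ _).symm k))
    simpa [adj.homEquiv_naturality_right] using h1
  -- The right adjoint preserves monomorphisms, and lifting problems against `L G` transpose to
  -- lifting problems against `G`.
  · have : IsIso (R.map i) := hP.isIso_of_mono _ fun G hG k => by
      obtain ⟨k', hk'⟩ := h _ (P.strictMap_obj L hG) ((adj.homEquiv _ _).symm k)
      refine ⟨adj.homEquiv _ _ k', ?_⟩
      have h1 := congrArg (adj.homEquiv _ _) hk'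
      simpa [adj.homEquiv_naturality_right] using h1
    exact isIso_of_reflects_iso i R

/-- The left adjoint keeps the ball objects ℵ₁-presentable because the forgetful functor preserves
ℵ₁-filtered colimits. -/
instance {𝕜 : Type} [RCLike 𝕜] :
    IsCardinalLocallyPresentable (OSys.{w} 𝕜) (Cardinal.aleph.{w} 1) := by
  let adj := Adjunction.ofIsRightAdjoint (forgetToOSp.{w} 𝕜)
  rw [IsCardinalLocallyPresentable.iff_exists_isStrongGenerator]
  refine ⟨(OSp.ballObjects.{w} 𝕜).strictMap (forgetToOSp.{w} 𝕜).leftAdjoint, inferInstance,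
    isStrongGenerator_strictMap adj OSp.isStrongGenerator_ballObjects, ?_⟩
  rintro _ ⟨_, ⟨n⟩⟩
  exact adj.isCardinalPresentable_leftAdjoint_obj (Cardinal.aleph.{w} 1) (OSp.ballObj.{w} 𝕜 n)

end OpCat

end

theorem mainTheorem1 (𝕜 : Type) [RCLike 𝕜] :
    -- both categories are locally `ℵ₁`-presentable
    IsCardinalLocallyPresentable (OpCat.OSp.{w} 𝕜) (Cardinal.aleph.{w} 1) ∧
    IsCardinalLocallyPresentable (OpCat.OSys.{w} 𝕜) (Cardinal.aleph.{w} 1) ∧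
    -- the forgetful functor has a left adjoint, is faithful, and its image on morphisms consists
    -- of the completely contractive maps preserving the order units
    (OpCat.forgetToOSp.{w} 𝕜).IsRightAdjoint ∧
    (OpCat.forgetToOSp.{w} 𝕜).Faithful ∧
    (∀ (S T : OpCat.OSys.{w} 𝕜)
      (f : (OpCat.forgetToOSp.{w} 𝕜).obj S ⟶ (OpCat.forgetToOSp.{w} 𝕜).obj T),
      (∃ g : S ⟶ T, (OpCat.forgetToOSp.{w} 𝕜).map g = f) ↔
        ConcreteCategory.hom f S.str.unit = T.str.unit) ∧
    -- it preserves `ℵ₁`-filtered colimits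
    (OpCat.forgetToOSp.{w} 𝕜).IsCardinalAccessible (Cardinal.aleph.{w} 1) ∧
    -- `ℵ₁`-filtered colimits are computed set-theoretically in both categories
    (forget (OpCat.OSp.{w} 𝕜)).IsCardinalAccessible (Cardinal.aleph.{w} 1) ∧
    (forget (OpCat.OSys.{w} 𝕜)).IsCardinalAccessible (Cardinal.aleph.{w} 1) :=
  ⟨inferInstance, inferInstance, inferInstance, inferInstance,
    fun _ _ f => OpCat.OSys.exists_forgetToOSp_map_eq_iff f,
    inferInstance, inferInstance, inferInstance⟩
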